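/- **Setting.** A rigid body with mass $m>0$, symmetric positive definite inertia matrix $J\in\mathbb R^{3\times3}$ and constant gravity $g$ moves according to $$\dot x=v,\qquad \dot R=R\hat\omega,\qquad m\dot v=-mg\,e_3+Rf_c,\qquad J\dot\omega=-\omega\times J\omega+\tau_c,$$ with $x,v,\omega\in\mathbb R^3$ and $R\in \mathrm{SO}(3)$; $\hat\omega$ is the matrix of $u\mapsto\omega\times u$ and $(\cdot)^\vee$ is the inverse of the hat map. Let $(x_d(t),R_d(t))$, $t\ge0$, be a reference curve of class $C^2$ in $\mathbb R^3\times\mathrm{SO}(3)$, with $v_d=\dot x_d$ and $\omega_d=(R_d^T\dot R_d)^\vee$, and assume that $\omega_d$ is bounded on $[0,\infty)$. The errors are $e_x=x-x_d$, $e_v=v-v_d$, $e_\omega=\omega-\omega_d$, $R_e=RR_d^T$. For $K_R=\mathrm{diag}(k_{R_1},k_{R_2},k_{R_3})$ let $$\Psi=\tfrac12\mathrm{tr}\big(K_R(1-R_e)\big),\qquad e_R=\Big(\tfrac12\big(K_RR_e-R_e^TK_R\big)\Big)^\vee .$$ The control law is $$f_c^d=-K_xe_x-K_ve_v+m(\dot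 v_d+ge_3),\qquad f_c=c(\Psi)R_d^Tf_c^d,\qquad c(\Psi)=\frac{\Psi_M-\Psi}{\Psi_M},$$ $$\tau_c=-R_d^Te_R-K_\omega e_\omega+J\dot\omega_d+\omega_d\times J\omega .$$ Let $\cos\theta_M>0$ and $f_M^d<f_M$, and assume $\|mge_3+m\dot v_d(t)\|\le f_M^d$ for all $t\ge 0$. The spherical sector is the set of forces $f\neq0$ with $f^Te_3/\|f\|\ge\cos\theta_M$ and $\|f\|\le f_M$. The reference is said to satisfy the cone condition along a motion if $f_c^d(t)\ne0$ and $f_c^d(t)^TR_d(t)e_3/\|f_c^d(t)\|\ge\cos\theta_M$ at all times $t$ of the motion. Put $$c_1=\min_{i\ne j}(k_{R_i}+k_{R_j}),\quad c_2=\max_{i\neq j}(k_{R_i}-k_{R_j})^2,\quad c_3=\max_{i\ne j}(k_{R_i}+k_{R_j}),\quad h_1=\frac{c_1}{c_2+c_3^2},$$ let $\lambda_m,\lambda_M$ denote the smallest and largest eigenvalue, and for constants $p_1,p_2>0$ let $$V=\tfrac12me_v^Te_v+\tfrac12e_x^TK_xe_x+p_2e_x^Te_v+\tfrac12e_\omega^TJe_\omega+\Psi+p_1e_\omega^Te_R,\qquad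 P_{x1}=\begin{pmatrix}\lambda_m(K_x)&-p_2\\-p_2&m\end{pmatrix}.$$ **Proposition (exponential stability of the full motion).** For every $\psi>0$ and every $0<f_{c_M}\le f_M-f_M^d$ there exist positive definite matrices $K_x,K_v,K_\omega$ and $K_R=\mathrm{diag}(k_{R_1},k_{R_2},k_{R_3})$ with $c_1>\psi$, a constant $\Psi_M>\psi$, constants $0<p_1<\sqrt{h_1\lambda_m(J)}$ and $0<p_2<\sqrt{m\lambda_m(K_x)}$, and constants $C,\lambda>0$ such that the following holds for every initial time $t_0\ge0$ and every initial state with $$\tfrac12e_\omega^T(t_0)Je_\omega(t_0)+\Psi(R_e(t_0))<\psi\qquad\text{and}\qquad V(t_0)<\frac{\lambda_m(P_{x1})f_{c_M}^2}{2\max\big(\lambda_M(K_x^TK_x),\lambda_M(K_v^TK_v)\big)}.$$ The closed-loop system has a solution on $[t_0,\infty)$ with this initial state, and for every such solution: 1. the zero equilibrium of $e=(e_x,e_R,e_v,e_\omega)$ is exponentially stable: $\|e(t)\|\le C\,e^{-\lambda(t-t_0)}\|e(t_0)\|$ for all $t\ge t_0$; 2. $\|f_c(t)\|\le f_M$ for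 all $t\ge t_0$ and, if the reference satisfies the cone condition along the solution, then $f_c(t)$ lies in the spherical sector for all $t\ge t_0$. -/

import Mathlib

open Matrix

namespace RigidBodyTracking

noncomputable section

/-- Column vectors of `ℝ³`; they carry the dot product `⬝ᵥ` and the cross product `⨯₃`. The Euclidean
norm is `euclNorm` below (the norm that Lean attaches to `Fin 3 → ℝ` is not used). -/
abbrev Vec3 := Fin 3 → ℝ

/-- Real `3 × 3` matrices. -/
abbrev Mat3 := Matrix (Fin 3) (Fin 3) ℝ

/-- The Euclidean norm on `ℝ³`. -/
def euclNorm (u : Vec3) : ℝ := √(u ⬝ᵥ u)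

/-- The third vector of the standard basis. -/
def e3 : Vec3 := ![0, 0, 1]

/-- The hat map: `hat ω` is the skew-symmetric matrix with `hat ω *ᵥ u = ω ⨯₃ u`. -/
def hat (ω : Vec3) : Mat3 :=
  !![0, -ω 2, ω 1;
     ω 2, 0, -ω 0;
     -ω 1, ω 0, 0]

/-- The vee map, inverse of the hat map on skew-symmetric matrices. -/
def vee (A : Mat3) : Vec3 := ![A 2 1, A 0 2, A 1 0]

/-- The skew-symmetric part of a matrix. -/
def skewPart (A : Mat3) : Mat3 := (1 / 2 : ℝ) • (A - Aᵀ)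

theorem hat_mulVec (ω u : Vec3) : hat ω *ᵥ u = ω ⨯₃ u := by
  ext i
  fin_cases i <;> simp [hat, crossProduct, Matrix.mulVec, dotProduct, Fin.sum_univ_three] <;> ring

theorem vee_hat (ω : Vec3) : vee (hat ω) = ω := by
  ext i
  fin_cases i <;> simp [vee, hat]

/-- Smallest real eigenvalue (used for symmetric matrices only). -/
def lamMin {n : ℕ} (A : Matrix (Fin n) (Fin n) ℝ) : ℝ := sInf (spectrum ℝ A)

/-- Largest real eigenvalue (used for symmetric matrices only). -/
def lamMax {n : ℕ} (A : Matrix (Fin n) (Fin n) ℝ) : ℝ := sSup (spectrum ℝ A)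

/-- A rigid body: mass `m`, inertia matrix `J` in the body frame, constant gravity `g`. -/
structure Body where
  m : ℝ
  g : ℝ
  J : Mat3
  m_pos : 0 < m
  J_posDef : J.PosDef

/-- A twice continuously differentiable reference curve `(xd t, Rd t)`, `t ≥ 0`, in `ℝ³ × SO(3)`,
together with its velocity `vd`, acceleration `ad`, body angular velocity `wd = (Rdᵀ Rd')^∨` and
angular acceleration `dwd`. -/
structure Reference where
  xd : ℝ → Vec3
  vd : ℝ → Vec3
  ad : ℝ → Vec3
  Rd : ℝ → Mat3
  wd : ℝ → Vec3
  dwd : ℝ → Vec3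
  Rd_mem : ∀ t, 0 ≤ t → Rd t ∈ specialOrthogonalGroup (Fin 3) ℝ
  xd_deriv : ∀ t, 0 ≤ t → HasDerivWithinAt xd (vd t) (Set.Ici 0) t
  vd_deriv : ∀ t, 0 ≤ t → HasDerivWithinAt vd (ad t) (Set.Ici 0) t
  ad_cont : ContinuousOn ad (Set.Ici 0)
  Rd_deriv : ∀ t, 0 ≤ t → HasDerivWithinAt Rd (Rd t * hat (wd t)) (Set.Ici 0) t
  wd_deriv : ∀ t, 0 ≤ t → HasDerivWithinAt wd (dwd t) (Set.Ici 0) t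
  dwd_cont : ContinuousOn dwd (Set.Ici 0)

/-- The controller parameters: gain matrices `Kx`, `Kv`, `Kw`, the diagonal `kR` of `K_R`, and the
constant `PsiM` of the scaling function. -/
structure Gains where
  Kx : Mat3
  Kv : Mat3
  Kw : Mat3
  kR : Vec3
  PsiM : ℝ

/-- The gain matrices `Kx`, `Kv`, `Kw` and `K_R = diag kR` are positive definite. -/
def Gains.Positive (K : Gains) : Prop :=
  K.Kx.PosDef ∧ K.Kv.PosDef ∧ K.Kw.PosDef ∧ ∀ i, 0 < K.kR i

/-- The diagonal matrix `K_R`. -/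
def Gains.KR (K : Gains) : Mat3 := Matrix.diagonal K.kR

/-- `c₁`, the smallest sum of two different rotational gains. -/
def Gains.c1 (K : Gains) : ℝ :=
  min (K.kR 0 + K.kR 1) (min (K.kR 1 + K.kR 2) (K.kR 2 + K.kR 0))

/-- `c₂`, the largest squared difference of two rotational gains. -/
def Gains.c2 (K : Gains) : ℝ :=
  max ((K.kR 0 - K.kR 1) ^ 2) (max ((K.kR 1 - K.kR 2) ^ 2) ((K.kR 2 - K.kR 0) ^ 2))

/-- `c₃`, the largest sum of two different rotational gains. -/
def Gains.c3 (K : Gains) : ℝ :=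
  max (K.kR 0 + K.kR 1) (max (K.kR 1 + K.kR 2) (K.kR 2 + K.kR 0))

/-- `h₁ = c₁ / (c₂ + c₃²)`, the constant of the lower bound `h₁ ‖e_R‖² ≤ Ψ`. -/
def Gains.h1 (K : Gains) : ℝ := K.c1 / (K.c2 + K.c3 ^ 2)

/-- The state of the body: position, attitude, inertial velocity, body angular velocity. -/
structure State where
  x : Vec3
  R : Mat3
  v : Vec3
  w : Vec3

section Errors

variable (P : Body) (r : Reference) (K : Gains) (t : ℝ) (s : State)

/-- Position error `e_x = x - x_d`. -/
def errX : Vec3 := s.x - r.xd t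

/-- Velocity error `e_v = v - v_d`. -/
def errV : Vec3 := s.v - r.vd t

/-- Angular velocity error `e_ω = ω - ω_d`. -/
def errW : Vec3 := s.w - r.wd t

/-- Left attitude error `R_e = R R_dᵀ`. -/
def attErr : Mat3 := s.R * (r.Rd t)ᵀ

/-- Navigation function `Ψ = ½ tr (K_R (1 - R_e))`. -/
def navFun : ℝ := (1 / 2) * (K.KR * (1 - attErr r t s)).trace

/-- Attitude error vector `e_R = skew (K_R R_e)^∨`. -/
def errR : Vec3 := vee (skewPart (K.KR * attErr r t s))

/-- Euclidean norm of the full tracking error `(e_x, e_R, e_v, e_ω)`. -/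
def errNorm : ℝ :=
  √(euclNorm (errX r t s) ^ 2 + euclNorm (errR r K t s) ^ 2 +
    euclNorm (errV r t s) ^ 2 + euclNorm (errW r t s) ^ 2)

/-- Desired force `f_c^d = -K_x e_x - K_v e_v + m (v_d' + g e₃)`, in the inertial frame. -/
def desiredForce : Vec3 :=
  -(K.Kx *ᵥ errX r t s) - K.Kv *ᵥ errV r t s + P.m • (r.ad t + P.g • e3)

/-- Scaling function `c(Ψ) = (Ψ_M - Ψ) / Ψ_M`. -/
def scaling (Psi : ℝ) : ℝ := (K.PsiM - Psi) / K.PsiM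

/-- Control force `f_c = c(Ψ) R_dᵀ f_c^d`, in the body frame. -/
def controlForce : Vec3 :=
  scaling K (navFun r K t s) • ((r.Rd t)ᵀ *ᵥ desiredForce P r K t s)

/-- Control torque `τ_c = -R_dᵀ e_R - K_ω e_ω + J ω_d' + ω_d × J ω`. -/
def controlTorque : Vec3 :=
  -((r.Rd t)ᵀ *ᵥ errR r K t s) - K.Kw *ᵥ errW r t s + P.J *ᵥ r.dwd t + r.wd t ⨯₃ (P.J *ᵥ s.w)

/-- Attitude energy `½ e_ωᵀ J e_ω + Ψ(R_e)`. -/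
def attEnergy : ℝ :=
  (1 / 2) * (errW r t s ⬝ᵥ P.J *ᵥ errW r t s) + navFun r K t s

/-- Translational Lyapunov function `V_x = ½ m e_vᵀ e_v + ½ e_xᵀ K_x e_x + p₂ e_xᵀ e_v`. -/
def lyapX (p₂ : ℝ) : ℝ :=
  (1 / 2) * P.m * (errV r t s ⬝ᵥ errV r t s) + (1 / 2) * (errX r t s ⬝ᵥ K.Kx *ᵥ errX r t s) +
    p₂ * (errX r t s ⬝ᵥ errV r t s)

/-- Rotational Lyapunov function `V_R = ½ e_ωᵀ J e_ω + Ψ(R_e) + p₁ e_ωᵀ e_R`. -/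
def lyapR (p₁ : ℝ) : ℝ :=
  attEnergy P r K t s + p₁ * (errW r t s ⬝ᵥ errR r K t s)

/-- The Lyapunov function `V = V_x + V_R`. -/
def lyap (p₁ p₂ : ℝ) : ℝ := lyapX P r K t s p₂ + lyapR P r K t s p₁

end Errors

/-- The matrix `P_{x1}` of the lower bound of `V_x`. -/
def matPx1 (P : Body) (K : Gains) (p₂ : ℝ) : Matrix (Fin 2) (Fin 2) ℝ :=
  !![lamMin K.Kx, -p₂;
     -p₂, P.m]

/-- The level of `V` below which the desired force correction stays below `fcM`. -/
def forceLevel (P : Body) (K : Gains) (p₂ fcM : ℝ) : ℝ :=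
  lamMin (matPx1 P K p₂) * fcM ^ 2 / (2 * max (lamMax (K.Kxᵀ * K.Kx)) (lamMax (K.Kvᵀ * K.Kv)))

/-- `s` is a motion of the rigid body on `[t₀, ∞)` under the control law:
`x' = v`, `R' = R ω̂`, `m v' = -m g e₃ + R f_c`, `J ω' = -ω × J ω + τ_c`, with `R ∈ SO(3)`. -/
structure IsClosedLoop (P : Body) (r : Reference) (K : Gains) (t₀ : ℝ) (s : ℝ → State) : Prop where
  R_mem : ∀ t, t₀ ≤ t → (s t).R ∈ specialOrthogonalGroup (Fin 3) ℝ
  x_deriv : ∀ t, t₀ ≤ t → HasDerivWithinAt (fun u => (s u).x) (s t).v (Set.Ici t₀) t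
  R_deriv : ∀ t, t₀ ≤ t →
    HasDerivWithinAt (fun u => (s u).R) ((s t).R * hat (s t).w) (Set.Ici t₀) t
  v_deriv : ∀ t, t₀ ≤ t →
    HasDerivWithinAt (fun u => P.m • (s u).v)
      (-((P.m * P.g) • e3) + (s t).R *ᵥ controlForce P r K t (s t)) (Set.Ici t₀) t
  w_deriv : ∀ t, t₀ ≤ t →
    HasDerivWithinAt (fun u => P.J *ᵥ (s u).w)
      (-((s t).w ⨯₃ (P.J *ᵥ (s t).w)) + controlTorque P r K t (s t)) (Set.Ici t₀) t

/-- The nonzero force `f` lies in the solid cone of half-angle `θM` about the unit vector `b`. -/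
def InCone (θM : ℝ) (b f : Vec3) : Prop :=
  f ≠ 0 ∧ Real.cos θM ≤ (f ⬝ᵥ b) / euclNorm f

/-- The force part of feasibility of the reference: the force `m (g e₃ + v_d')` needed by the
reference motion stays below `fMd`, which is below the maximal force `fM`. -/
def Reference.ForceFeasible (r : Reference) (P : Body) (fMd fM : ℝ) : Prop :=
  fMd < fM ∧ ∀ t, 0 ≤ t → euclNorm ((P.m * P.g) • e3 + P.m • r.ad t) ≤ fMd

/-- The cone part of feasibility of the reference, which refers to the desired force and so is a
condition along a motion `s`: the desired force stays in the cone about the desired third axis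
`b_{d3} = R_d e₃`. -/
def Reference.ConeFeasible (r : Reference) (P : Body) (K : Gains) (θM t₀ : ℝ) (s : ℝ → State) :
    Prop :=
  ∀ t, t₀ ≤ t → InCone θM (r.Rd t *ᵥ e3) (desiredForce P r K t (s t))

end

end RigidBodyTracking

namespace RigidBodyTracking

noncomputable section

/-! The gains are free, so all are taken scalar: `Kx = m/4`, `Kv = m/2`, `Kw = 1`, `K_R = k`, `PsiM
= 2k`, `p₂ = m/4`, with only `k` left to be chosen large. If `θ` is the angle of the attitude error,
then `Ψ = k(1 - cos θ)` and `‖e_R‖ = k |sin θ|`, so `Ψ ≤ k` keeps `θ` at most a right angle and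
makes `kΨ` comparable with `‖e_R‖²`.

The attitude loop does not see the translation. Its energy has derivative `-‖e_ω‖²`
(`IsMotionOn.attEnergy_deriv`), so `Ψ` stays below `ψ`. Adding a small multiple of the product of
angular momentum and attitude error makes this energy strictly decreasing, uniformly in time because
`ω_d` is bounded (`exists_rotLyap`).

The translation is a linear damped oscillator disturbed by the defect `R f_c - f_c^d`, whose square
is at most `(9/k) Ψ ‖f_c^d‖²` (`forceDefect_sq_le`). Since `Ψ < ψ`, a large `k` makes the
disturbance so weak that the sublevel `V_x ≤ fcM²/(2m)` is forward invariant
(`IsMotionOn.lyapX_le_level`); this bounds the desired force by `fcM + fMd ≤ fM`. With the force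
bounded, the squared defect is at most a constant times `‖e_R‖²`, and `V_x` plus a large multiple of
the rotational function decays exponentially (`exists_exponential_bound`). The function `V` of the
statement is needed only initially: its rotational part is nonnegative (`lyapR_nonneg`) and the
prescribed level is at most `fcM²/(2m)` (`forceLevel_le`).

Global existence follows from the same estimates, proved for motions on compact intervals: the
closed loop is a `C¹` field in coordinates, `SO(3)` is invariant, and bounded solutions extend
(`exists_isClosedLoop`). -/

/-! ### Euclidean norm, quadratic forms and extreme eigenvalues. -/

theorem dot_self_nonneg (u : Vec3) : 0 ≤ u ⬝ᵥ u := by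
  simp only [dotProduct, Fin.sum_univ_three]
  nlinarith [mul_self_nonneg (u 0), mul_self_nonneg (u 1), mul_self_nonneg (u 2)]

theorem euclNorm_nonneg (u : Vec3) : 0 ≤ euclNorm u := Real.sqrt_nonneg _

theorem euclNorm_sq (u : Vec3) : euclNorm u ^ 2 = u ⬝ᵥ u := Real.sq_sqrt (dot_self_nonneg u)

theorem euclNorm_le_of_dot_le {u : Vec3} {c : ℝ} (hc : 0 ≤ c) (h : u ⬝ᵥ u ≤ c ^ 2) :
    euclNorm u ≤ c := by
  rw [euclNorm, Real.sqrt_le_left hc]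
  exact h

theorem euclNorm_eq_norm (u : Vec3) : euclNorm u = ‖WithLp.toLp 2 u‖ := by
  rw [EuclideanSpace.norm_eq, euclNorm]
  congr 1
  simp [dotProduct, sq]

theorem euclNorm_add_le (u v : Vec3) : euclNorm (u + v) ≤ euclNorm u + euclNorm v := by
  simp only [euclNorm_eq_norm, WithLp.toLp_add]
  exact norm_add_le _ _

theorem euclNorm_neg (u : Vec3) : euclNorm (-u) = euclNorm u := by
  simp [euclNorm]

theorem euclNorm_smul (c : ℝ) (u : Vec3) : euclNorm (c • u) = |c| * euclNorm u := by
  simp only [euclNorm_eq_norm, WithLp.toLp_smul, norm_smul, Real.norm_eq_abs]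

theorem abs_dot_le (u v : Vec3) : |u ⬝ᵥ v| ≤ euclNorm u * euclNorm v := by
  refine abs_le_of_sq_le_sq ?_ (mul_nonneg (euclNorm_nonneg u) (euclNorm_nonneg v))
  rw [mul_pow, euclNorm_sq, euclNorm_sq]
  simp only [dotProduct, Fin.sum_univ_three]
  nlinarith [sq_nonneg (u 0 * v 1 - u 1 * v 0), sq_nonneg (u 1 * v 2 - u 2 * v 1),
    sq_nonneg (u 2 * v 0 - u 0 * v 2)]

theorem dot_le (u v : Vec3) : u ⬝ᵥ v ≤ euclNorm u * euclNorm v :=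
  (le_abs_self _).trans (abs_dot_le u v)

theorem neg_dot_le (u v : Vec3) : -(u ⬝ᵥ v) ≤ euclNorm u * euclNorm v :=
  (neg_le_abs _).trans (abs_dot_le u v)

theorem euclNorm_cross_le (u v : Vec3) : euclNorm (u ⨯₃ v) ≤ euclNorm u * euclNorm v := by
  apply euclNorm_le_of_dot_le (mul_nonneg (euclNorm_nonneg u) (euclNorm_nonneg v))
  rw [mul_pow, euclNorm_sq, euclNorm_sq]
  simp only [dotProduct, Fin.sum_univ_three, crossProduct, LinearMap.mk₂_apply, Matrix.cons_val]
  nlinarith [sq_nonneg (u 0 * v 0 + u 1 * v 1 + u 2 * v 2)]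

/-- A matrix acts boundedly for the Euclidean norm. -/
theorem exists_euclNorm_mulVec_le (A : Mat3) :
    ∃ c, 0 < c ∧ ∀ u, euclNorm (A *ᵥ u) ≤ c * euclNorm u := by
  let T := (Matrix.toEuclideanLin A).toContinuousLinearMap
  refine ⟨‖T‖ + 1, by positivity, fun u => ?_⟩
  have h := T.le_opNorm (WithLp.toLp 2 u)
  have e : T (WithLp.toLp 2 u) = WithLp.toLp 2 (A *ᵥ u) := by
    simp [T, Matrix.toEuclideanLin]
  rw [e, ← euclNorm_eq_norm, ← euclNorm_eq_norm] at h
  nlinarith [euclNorm_nonneg u]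

/-- The constant is the minimum of the quadratic form on the unit sphere, attained by compactness;
homogeneity does the rest. -/
theorem PosDef.exists_le_dot {J : Mat3} (hJ : J.PosDef) :
    ∃ c, 0 < c ∧ ∀ u : Vec3, c * (u ⬝ᵥ u) ≤ u ⬝ᵥ J *ᵥ u := by
  have hcont : Continuous fun u : Vec3 => u ⬝ᵥ J *ᵥ u := by
    simp only [dotProduct, Matrix.mulVec]; fun_prop
  have hdot : Continuous fun u : Vec3 => u ⬝ᵥ u := by
    simp only [dotProduct]; fun_prop
  have hcomp : IsCompact {u : Vec3 | u ⬝ᵥ u = 1} := by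
    refine Metric.isCompact_of_isClosed_isBounded (isClosed_eq hdot continuous_const) ?_
    refine (Metric.isBounded_closedBall (x := (0 : Vec3)) (r := 1)).subset fun u hu => ?_
    rw [mem_closedBall_zero_iff, pi_norm_le_iff_of_nonneg zero_le_one]
    intro i
    have h : u i * u i ≤ u ⬝ᵥ u :=
      Finset.single_le_sum (f := fun j => u j * u j) (fun j _ => mul_self_nonneg _)
        (Finset.mem_univ i)
    rw [show u ⬝ᵥ u = 1 from hu] at h
    rw [Real.norm_eq_abs, ← sq_le_one_iff_abs_le_one, sq]
    exact h
  obtain ⟨u₀, hu₀, hmin⟩ := hcomp.exists_isMinOn ⟨e3, by simp [e3]⟩ hcont.continuousOn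
  have hu₀' : u₀ ≠ 0 := by
    rintro rfl; simp at hu₀
  refine ⟨u₀ ⬝ᵥ J *ᵥ u₀, by simpa using hJ.dotProduct_mulVec_pos hu₀', fun u => ?_⟩
  rcases eq_or_ne u 0 with rfl | hu
  · simp
  · have hn : 0 < euclNorm u := Real.sqrt_pos.mpr <| by
      simpa using (dotProduct_self_star_pos_iff (v := u)).mpr hu
    have hmem : ((euclNorm u)⁻¹ • u) ⬝ᵥ ((euclNorm u)⁻¹ • u) = 1 := by
      rw [smul_dotProduct, dotProduct_smul, ← euclNorm_sq]
      simp only [smul_eq_mul]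
      field_simp
    have h := hmin (show _ ∈ {u : Vec3 | u ⬝ᵥ u = 1} from hmem)
    simp only [Set.mem_ofPred_eq, Matrix.mulVec_smul, smul_dotProduct, dotProduct_smul,
      smul_eq_mul] at h
    rw [← euclNorm_sq]
    calc _ ≤ ((euclNorm u)⁻¹ * ((euclNorm u)⁻¹ * (u ⬝ᵥ J *ᵥ u))) * euclNorm u ^ 2 := by gcongr
      _ = _ := by field_simp

theorem lamMin_pos {J : Mat3} (hJ : J.PosDef) : 0 < lamMin J := by
  have hne : (spectrum ℝ J).Nonempty := by
    rw [hJ.isHermitian.spectrum_real_eq_range_eigenvalues]; exact Set.range_nonempty _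
  have hmem : sInf (spectrum ℝ J) ∈ spectrum ℝ J :=
    hne.csInf_mem J.finite_real_spectrum
  rw [lamMin]
  generalize sInf (spectrum ℝ J) = x at hmem
  rw [hJ.isHermitian.spectrum_real_eq_range_eigenvalues] at hmem
  obtain ⟨i, rfl⟩ := hmem
  exact hJ.eigenvalues_pos i

theorem spectrum_smul_one (c : ℝ) : spectrum ℝ (c • (1 : Mat3)) = {c} := by
  rw [← Algebra.algebraMap_eq_smul_one]
  exact spectrum.scalar_eq c

theorem lamMin_smul_one (c : ℝ) : lamMin (c • (1 : Mat3)) = c := by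
  rw [lamMin, spectrum_smul_one, csInf_singleton]

theorem lamMax_smul_one (c : ℝ) : lamMax (c • (1 : Mat3)) = c := by
  rw [lamMax, spectrum_smul_one, csSup_singleton]

theorem lamMin_le {n : ℕ} {A : Matrix (Fin n) (Fin n) ℝ} {μ : ℝ} (h : (scalar (Fin n) μ - A).det = 0) :
    lamMin A ≤ μ := by
  refine csInf_le A.finite_real_spectrum.bddBelow ?_
  rw [spectrum.mem_iff, Matrix.isUnit_iff_isUnit_det]
  change ¬ IsUnit (scalar (Fin n) μ - A).det
  rw [h]; exact not_isUnit_zero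

theorem posDef_smul_one {c : ℝ} (hc : 0 < c) : (c • (1 : Mat3)).PosDef := by
  exact Matrix.PosDef.one.smul hc

/-! ### Rotation matrices -/

theorem trace_eq (A : Mat3) : A.trace = A 0 0 + A 1 1 + A 2 2 := by
  simp [Matrix.trace, Fin.sum_univ_three]

theorem transpose_mul_self_of_mem {A : Mat3} (hA : A ∈ specialOrthogonalGroup (Fin 3) ℝ) :
    Aᵀ * A = 1 :=
  (mem_orthogonalGroup_iff' ..).mp (mem_specialOrthogonalGroup_iff.mp hA).1

theorem mul_transpose_self_of_mem {A : Mat3} (hA : A ∈ specialOrthogonalGroup (Fin 3) ℝ) :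
    A * Aᵀ = 1 :=
  (mem_orthogonalGroup_iff ..).mp (mem_specialOrthogonalGroup_iff.mp hA).1

theorem transpose_mem {A : Mat3} (hA : A ∈ specialOrthogonalGroup (Fin 3) ℝ) :
    Aᵀ ∈ specialOrthogonalGroup (Fin 3) ℝ := by
  rw [mem_specialOrthogonalGroup_iff, mem_orthogonalGroup_iff, det_transpose, transpose_transpose]
  exact ⟨transpose_mul_self_of_mem hA, hA.2⟩

/-- Read entrywise, this says that each entry of a rotation equals its own cofactor; these quadratic
relations are what the later polynomial identities need beyond orthonormality. -/
theorem adjugate_eq_transpose {A : Mat3} (hA : A ∈ specialOrthogonalGroup (Fin 3) ℝ) :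
    A.adjugate = Aᵀ := by
  have h : A * A.adjugate = 1 := by
    rw [mul_adjugate, (mem_specialOrthogonalGroup_iff.mp hA).2, one_smul]
  calc A.adjugate = Aᵀ * A * A.adjugate := by rw [transpose_mul_self_of_mem hA, Matrix.one_mul]
    _ = Aᵀ := by rw [Matrix.mul_assoc, h, Matrix.mul_one]

theorem entry_mul_transpose {A : Mat3} (h : A * Aᵀ = 1) (i j : Fin 3) :
    A i 0 * A j 0 + A i 1 * A j 1 + A i 2 * A j 2 = if i = j then 1 else 0 := by
  have := congrFun (congrFun h i) j
  simpa [Matrix.mul_apply, Fin.sum_univ_three, Matrix.one_apply] using this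

theorem trace_le_three {A : Mat3} (hA : A ∈ specialOrthogonalGroup (Fin 3) ℝ) : A.trace ≤ 3 := by
  have h := mul_transpose_self_of_mem hA
  have h0 := entry_mul_transpose h 0 0
  have h1 := entry_mul_transpose h 1 1
  have h2 := entry_mul_transpose h 2 2
  simp only [if_true] at h0 h1 h2
  rw [trace_eq]
  nlinarith [sq_nonneg (A 0 0 - 1), sq_nonneg (A 1 1 - 1), sq_nonneg (A 2 2 - 1),
    sq_nonneg (A 0 1), sq_nonneg (A 0 2), sq_nonneg (A 1 0), sq_nonneg (A 1 2),
    sq_nonneg (A 2 0), sq_nonneg (A 2 1)]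

/-- `‖skew(A)^∨‖² = sin² θ` in terms of `tr A = 1 + 2 cos θ`. -/
theorem vee_skewPart_sq {A : Mat3} (hA : A ∈ specialOrthogonalGroup (Fin 3) ℝ) :
    vee (skewPart A) ⬝ᵥ vee (skewPart A) = (3 - A.trace) * (1 + A.trace) / 4 := by
  have h := mul_transpose_self_of_mem hA
  have h0 := entry_mul_transpose h 0 0
  have h1 := entry_mul_transpose h 1 1
  have h2 := entry_mul_transpose h 2 2
  simp only [if_true] at h0 h1 h2
  have hadj := adjugate_eq_transpose hA
  rw [adjugate_fin_three] at hadj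
  have c0 := congrFun (congrFun hadj 0) 0
  have c1 := congrFun (congrFun hadj 1) 1
  have c2 := congrFun (congrFun hadj 2) 2
  simp at c0 c1 c2
  simp only [trace_eq, dotProduct, Fin.sum_univ_three, vee, skewPart, Matrix.smul_apply,
    Matrix.sub_apply, Matrix.transpose_apply, Matrix.cons_val, smul_eq_mul]
  -- The row norms remove the squares of entries; the diagonal cofactors replace each product `A i j
  -- * A j i` by `A i i * A j j` minus the third diagonal entry.
  linear_combination (1 / 4) * (h0 + h1 + h2) + (1 / 2) * (c0 + c1 + c2)

/-- Rotations preserve the cross product, so they intertwine the vee map with conjugation. This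
moves the attitude error from `R R_dᵀ` to `R_dᵀ R`, the form in which it enters the torque. -/
theorem transpose_mulVec_vee_skewPart {Q : Mat3} (hQ : Q ∈ specialOrthogonalGroup (Fin 3) ℝ)
    (M : Mat3) : Qᵀ *ᵥ vee (skewPart M) = vee (skewPart (Qᵀ * M * Q)) := by
  have hadj := adjugate_eq_transpose hQ
  rw [adjugate_fin_three] at hadj
  have c : ∀ i j, _ := fun i j => congrFun (congrFun hadj i) j
  ext i
  have c0 := c i 0
  have c1 := c i 1
  have c2 := c i 2
  simp only [mulVec, dotProduct, Fin.sum_univ_three, vee, skewPart, Matrix.smul_apply,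
    Matrix.sub_apply, Matrix.transpose_apply, Matrix.cons_val, smul_eq_mul, Matrix.mul_apply]
  fin_cases i <;> simp at c0 c1 c2 ⊢ <;>
  linear_combination -(1 / 2) * ((M 2 1 - M 1 2) * c0 + (M 0 2 - M 2 0) * c1 + (M 1 0 - M 0 1) * c2)

theorem vee_skewPart_sq_le (M : Mat3) :
    vee (skewPart M) ⬝ᵥ vee (skewPart M) ≤ (1 / 2) * (Mᵀ * M).trace := by
  simp only [trace_eq, dotProduct, Fin.sum_univ_three, vee, skewPart, Matrix.smul_apply,
    Matrix.sub_apply, Matrix.transpose_apply, Matrix.cons_val, smul_eq_mul, Matrix.mul_apply]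
  nlinarith [sq_nonneg (M 2 1 + M 1 2), sq_nonneg (M 0 2 + M 2 0), sq_nonneg (M 1 0 + M 0 1),
    sq_nonneg (M 0 0), sq_nonneg (M 1 1), sq_nonneg (M 2 2)]

/-- A rotation preserves the Frobenius norm, and the squared Frobenius norm of `hat u` is twice that
of `u`. -/
theorem euclNorm_vee_skewPart_mul_hat_le {B : Mat3} (hB : B ∈ specialOrthogonalGroup (Fin 3) ℝ)
    (u : Vec3) : euclNorm (vee (skewPart (B * hat u))) ≤ euclNorm u := by
  refine euclNorm_le_of_dot_le (euclNorm_nonneg u) ?_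
  rw [euclNorm_sq]
  refine (vee_skewPart_sq_le _).trans_eq ?_
  have : (B * hat u)ᵀ * (B * hat u) = (hat u)ᵀ * hat u := by
    rw [transpose_mul, Matrix.mul_assoc, ← Matrix.mul_assoc Bᵀ, transpose_mul_self_of_mem hB,
      Matrix.one_mul]
  rw [this]
  simp [trace_eq, hat, dotProduct, Fin.sum_univ_three, Matrix.mul_apply]
  ring

theorem mulVec_dot_mulVec {A : Mat3} (hA : A ∈ specialOrthogonalGroup (Fin 3) ℝ) (u v : Vec3) :
    (A *ᵥ u) ⬝ᵥ (A *ᵥ v) = u ⬝ᵥ v := by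
  rw [dotProduct_mulVec, ← mulVec_transpose, mulVec_mulVec, transpose_mul_self_of_mem hA,
    one_mulVec]

theorem euclNorm_mulVec {A : Mat3} (hA : A ∈ specialOrthogonalGroup (Fin 3) ℝ) (u : Vec3) :
    euclNorm (A *ᵥ u) = euclNorm u := by
  rw [euclNorm, mulVec_dot_mulVec hA, euclNorm]

/-- The Frobenius norm bounds the action of a matrix. -/
theorem mulVec_sq_le (M : Mat3) (u : Vec3) :
    (M *ᵥ u) ⬝ᵥ (M *ᵥ u) ≤ (M * Mᵀ).trace * (u ⬝ᵥ u) := by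
  have h : ∀ i, (M *ᵥ u) i * (M *ᵥ u) i ≤ (M i ⬝ᵥ M i) * (u ⬝ᵥ u) := fun i => by
    have := abs_dot_le (M i) u
    have h2 := mul_self_le_mul_self (abs_nonneg _) this
    rw [abs_mul_abs_self] at h2
    refine h2.trans_eq ?_
    rw [← euclNorm_sq, ← euclNorm_sq]; ring
  have : (M * Mᵀ).trace = M 0 ⬝ᵥ M 0 + M 1 ⬝ᵥ M 1 + M 2 ⬝ᵥ M 2 := by
    simp [trace_eq, Matrix.mul_apply, dotProduct]
  rw [this]
  calc (M *ᵥ u) ⬝ᵥ (M *ᵥ u) = (M *ᵥ u) 0 * (M *ᵥ u) 0 + (M *ᵥ u) 1 * (M *ᵥ u) 1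
      + (M *ᵥ u) 2 * (M *ᵥ u) 2 := by simp [dotProduct, Fin.sum_univ_three]
    _ ≤ _ := by linarith [h 0, h 1, h 2]

/-- The factor is the squared Frobenius norm of `A - 1`, which is `6 - 2 tr A` for a rotation. -/
theorem mulVec_sub_self_sq_le {A : Mat3} (hA : A ∈ specialOrthogonalGroup (Fin 3) ℝ) (f : Vec3) :
    (A *ᵥ f - f) ⬝ᵥ (A *ᵥ f - f) ≤ 2 * (3 - A.trace) * (f ⬝ᵥ f) := by
  have h := mulVec_sq_le (A - 1) f
  rw [sub_mulVec, one_mulVec] at h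
  refine h.trans_eq ?_
  congr 1
  have : (A - 1) * (A - 1)ᵀ = A * Aᵀ - A - Aᵀ + 1 := by
    rw [transpose_sub, transpose_one]; noncomm_ring
  rw [this, mul_transpose_self_of_mem hA]
  simp [trace_add, trace_sub]
  ring

theorem trace_mul_hat (B : Mat3) (u : Vec3) :
    (B * hat u).trace = -2 * (vee (skewPart B) ⬝ᵥ u) := by
  simp [trace_eq, hat, dotProduct, Fin.sum_univ_three, Matrix.mul_apply, vee, skewPart]
  ring

/-- The symmetric part of `B` has a symmetric commutator with `hat u` and drops out; on skew
matrices the commutator is the cross product. -/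
theorem vee_skewPart_commutator (B : Mat3) (u : Vec3) :
    vee (skewPart (B * hat u - hat u * B)) = vee (skewPart B) ⨯₃ u := by
  ext i
  fin_cases i <;> simp [hat, Fin.sum_univ_three, Matrix.mul_apply, vee, skewPart,
    crossProduct, Matrix.vecMul, dotProduct] <;> ring

/-! ### Derivatives of vector and matrix expressions -/

section Deriv

variable {S : Set ℝ} {t : ℝ}

theorem hasDerivWithinAt_mat {A : ℝ → Mat3} {A' : Mat3} :
    HasDerivWithinAt A A' S t ↔ ∀ i j, HasDerivWithinAt (fun u => A u i j) (A' i j) S t := by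
  have h1 : HasDerivWithinAt A A' S t ↔ ∀ i, HasDerivWithinAt (fun u => A u i) (A' i) S t :=
    hasDerivWithinAt_pi (φ := fun u => (A u : Fin 3 → Fin 3 → ℝ))
  rw [h1]
  exact forall_congr' fun i => hasDerivWithinAt_pi

theorem hasDerivWithinAt_mat_mono {A : ℝ → Mat3} {A' : Mat3} {S' : Set ℝ}
    (hA : HasDerivWithinAt A A' S' t) (hS : S ⊆ S') : HasDerivWithinAt A A' S t := by
  rw [hasDerivWithinAt_mat] at hA ⊢
  exact fun i j => (hA i j).mono hS

theorem hasDerivWithinAt_dot {u v : ℝ → Vec3} {u' v' : Vec3} (hu : HasDerivWithinAt u u' S t)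
    (hv : HasDerivWithinAt v v' S t) :
    HasDerivWithinAt (fun x => u x ⬝ᵥ v x) (u' ⬝ᵥ v t + u t ⬝ᵥ v') S t := by
  rw [hasDerivWithinAt_pi] at hu hv
  simp only [dotProduct, ← Finset.sum_add_distrib]
  exact HasDerivWithinAt.fun_sum fun i _ => (hu i).mul (hv i)

theorem hasDerivWithinAt_const_mulVec (A : Mat3) {v : ℝ → Vec3} {v' : Vec3}
    (hv : HasDerivWithinAt v v' S t) : HasDerivWithinAt (fun x => A *ᵥ v x) (A *ᵥ v') S t := by
  rw [hasDerivWithinAt_pi]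
  intro i
  refine (hasDerivWithinAt_dot (hasDerivWithinAt_const t S (A i)) hv).congr_deriv ?_
  rw [zero_dotProduct, zero_add]
  rfl

theorem hasDerivWithinAt_transpose {A : ℝ → Mat3} {A' : Mat3} (hA : HasDerivWithinAt A A' S t) :
    HasDerivWithinAt (fun x => (A x)ᵀ) A'ᵀ S t := by
  rw [hasDerivWithinAt_mat] at hA ⊢
  exact fun i j => hA j i

theorem hasDerivWithinAt_matMul {A B : ℝ → Mat3} {A' B' : Mat3} (hA : HasDerivWithinAt A A' S t)
    (hB : HasDerivWithinAt B B' S t) :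
    HasDerivWithinAt (fun x => A x * B x) (A' * B t + A t * B') S t := by
  have hB' := hasDerivWithinAt_mat.mp (hasDerivWithinAt_transpose hB)
  rw [hasDerivWithinAt_mat] at hA ⊢
  exact fun i j => hasDerivWithinAt_dot (hasDerivWithinAt_pi.mpr (hA i))
    (hasDerivWithinAt_pi.mpr (hB' j))

theorem hasDerivWithinAt_trace {A : ℝ → Mat3} {A' : Mat3} (hA : HasDerivWithinAt A A' S t) :
    HasDerivWithinAt (fun x => (A x).trace) A'.trace S t := by
  rw [hasDerivWithinAt_mat] at hA
  exact HasDerivWithinAt.fun_sum fun i _ => hA i i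

theorem hasDerivWithinAt_vee_skewPart {A : ℝ → Mat3} {A' : Mat3}
    (hA : HasDerivWithinAt A A' S t) :
    HasDerivWithinAt (fun x => vee (skewPart (A x))) (vee (skewPart A')) S t := by
  rw [hasDerivWithinAt_mat] at hA
  rw [hasDerivWithinAt_pi]
  intro i
  fin_cases i
  · exact ((hA 2 1).sub (hA 1 2)).const_mul (1 / 2)
  · exact ((hA 0 2).sub (hA 2 0)).const_mul (1 / 2)
  · exact ((hA 1 0).sub (hA 0 1)).const_mul (1 / 2)

/-- Scalar comparison: `f' ≤ -c f` implies exponential decay. -/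
theorem le_exp_mul_of_deriv_le {a b c : ℝ} {f f' : ℝ → ℝ}
    (hf : ∀ t ∈ Set.Icc a b, HasDerivWithinAt f (f' t) (Set.Icc a b) t)
    (hle : ∀ t ∈ Set.Icc a b, f' t ≤ -c * f t) :
    ∀ t ∈ Set.Icc a b, f t ≤ Real.exp (-c * (t - a)) * f a := by
  have hg : ∀ t ∈ Set.Icc a b, HasDerivWithinAt (fun t => Real.exp (c * (t - a)) * f t)
      (Real.exp (c * (t - a)) * (c * f t + f' t)) (Set.Icc a b) t := fun t ht => by
    have h1 : HasDerivAt (fun t => Real.exp (c * (t - a))) (Real.exp (c * (t - a)) * (c * 1)) t :=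
      (((hasDerivAt_id t).sub_const a).const_mul c).exp
    refine (h1.hasDerivWithinAt.mul (hf t ht)).congr_deriv ?_
    ring
  have hanti : AntitoneOn (fun t => Real.exp (c * (t - a)) * f t) (Set.Icc a b) := by
    refine antitoneOn_of_hasDerivWithinAt_nonpos (convex_Icc a b)
      (f' := fun t => Real.exp (c * (t - a)) * (c * f t + f' t))
      (fun t ht => (hg t ht).continuousWithinAt)
      (fun t ht => (hg t (interior_subset ht)).mono interior_subset) fun t ht => ?_
    have := hle t (interior_subset ht)
    exact mul_nonpos_of_nonneg_of_nonpos (Real.exp_pos _).le (by linarith)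
  intro t ht
  have h := hanti (Set.left_mem_Icc.mpr (ht.1.trans ht.2)) ht ht.1
  simp only [sub_self, mul_zero, Real.exp_zero, one_mul] at h
  rw [show -c * (t - a) = -(c * (t - a)) by ring, Real.exp_neg, inv_mul_eq_div,
    le_div_iff₀ (Real.exp_pos _)]
  linarith

end Deriv

/-! ### Motions on a time set -/

/-- `s` satisfies the closed-loop equations on the time set `S`. -/
structure IsMotionOn (P : Body) (r : Reference) (K : Gains) (S : Set ℝ) (s : ℝ → State) :
    Prop where
  R_mem : ∀ t ∈ S, (s t).R ∈ specialOrthogonalGroup (Fin 3) ℝ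
  x_deriv : ∀ t ∈ S, HasDerivWithinAt (fun u => (s u).x) (s t).v S t
  R_deriv : ∀ t ∈ S, HasDerivWithinAt (fun u => (s u).R) ((s t).R * hat (s t).w) S t
  v_deriv : ∀ t ∈ S, HasDerivWithinAt (fun u => P.m • (s u).v)
      (-((P.m * P.g) • e3) + (s t).R *ᵥ controlForce P r K t (s t)) S t
  w_deriv : ∀ t ∈ S, HasDerivWithinAt (fun u => P.J *ᵥ (s u).w)
      (-((s t).w ⨯₃ (P.J *ᵥ (s t).w)) + controlTorque P r K t (s t)) S t

theorem IsClosedLoop.isMotionOn {P : Body} {r : Reference} {K : Gains} {t₀ : ℝ} {s : ℝ → State}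
    (h : IsClosedLoop P r K t₀ s) {S : Set ℝ} (hS : S ⊆ Set.Ici t₀) : IsMotionOn P r K S s where
  R_mem t ht := h.R_mem t (hS ht)
  x_deriv t ht := (h.x_deriv t (hS ht)).mono hS
  R_deriv t ht := hasDerivWithinAt_mat_mono (h.R_deriv t (hS ht)) hS
  v_deriv t ht := (h.v_deriv t (hS ht)).mono hS
  w_deriv t ht := (h.w_deriv t (hS ht)).mono hS

/-- Scalar gains; the only free parameter is the rotational gain `k`. -/
def scalarGains (P : Body) (k : ℝ) : Gains where
  -- With these two gains and `p₂ = m/4`, the undisturbed translation satisfies `V_x' = -V_x/2`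
  -- exactly.
  Kx := (P.m / 4) • 1
  Kv := (P.m / 2) • 1
  Kw := 1
  kR := fun _ => k
  -- The maximum of `Ψ` over the rotations, so that the scaling factor is `1 - Ψ/(2k)` and lies in
  -- `[0, 1]`.
  PsiM := 2 * k

/-- The attitude error in the reference frame, `R_dᵀ R`. -/
def relAtt (r : Reference) (t : ℝ) (s : State) : Mat3 := (r.Rd t)ᵀ * s.R

/-- The vector `R_dᵀ e_R`, for scalar rotational gain. -/
def bodyErr (r : Reference) (k t : ℝ) (s : State) : Vec3 := k • vee (skewPart (relAtt r t s))

/-- The force defect `R f_c - f_c^d` caused by the attitude error. -/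
def forceDefect (P : Body) (r : Reference) (K : Gains) (t : ℝ) (s : State) : Vec3 :=
  s.R *ᵥ controlForce P r K t s - desiredForce P r K t s

/-! ### Pointwise identities and estimates for scalar gains. -/

section Static

variable {P : Body} {r : Reference} {k t : ℝ} {s : State}

theorem KR_scalarGains : (scalarGains P k).KR = k • (1 : Mat3) := by
  rw [Gains.KR, smul_one_eq_diagonal]; rfl

theorem relAtt_mem (ht : 0 ≤ t) (hR : s.R ∈ specialOrthogonalGroup (Fin 3) ℝ) :
    relAtt r t s ∈ specialOrthogonalGroup (Fin 3) ℝ :=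
  mul_mem (transpose_mem (r.Rd_mem t ht)) hR

theorem attErr_mem (ht : 0 ≤ t) (hR : s.R ∈ specialOrthogonalGroup (Fin 3) ℝ) :
    attErr r t s ∈ specialOrthogonalGroup (Fin 3) ℝ :=
  mul_mem hR (transpose_mem (r.Rd_mem t ht))

theorem trace_attErr : (attErr r t s).trace = (relAtt r t s).trace := by
  rw [attErr, relAtt, Matrix.trace_mul_comm]

theorem navFun_eq : navFun r (scalarGains P k) t s = (k / 2) * (3 - (relAtt r t s).trace) := by
  rw [navFun, KR_scalarGains, smul_mul_assoc, Matrix.one_mul, trace_smul, trace_sub, trace_attErr,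
    trace_one]
  simp
  ring

theorem skewPart_smul (c : ℝ) (M : Mat3) : vee (skewPart (c • M)) = c • vee (skewPart M) := by
  ext i
  fin_cases i <;> simp [vee, skewPart] <;> ring

theorem errR_eq : errR r (scalarGains P k) t s = k • vee (skewPart (attErr r t s)) := by
  rw [errR, KR_scalarGains, smul_mul_assoc, Matrix.one_mul, skewPart_smul]

theorem transpose_mulVec_errR (ht : 0 ≤ t) :
    (r.Rd t)ᵀ *ᵥ errR r (scalarGains P k) t s = bodyErr r k t s := by
  rw [errR_eq, mulVec_smul, transpose_mulVec_vee_skewPart (r.Rd_mem t ht), bodyErr, relAtt, attErr]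
  rw [Matrix.mul_assoc, Matrix.mul_assoc, transpose_mul_self_of_mem (r.Rd_mem t ht),
    Matrix.mul_one]

theorem euclNorm_errR (ht : 0 ≤ t) :
    euclNorm (errR r (scalarGains P k) t s) = euclNorm (bodyErr r k t s) := by
  rw [← transpose_mulVec_errR (P := P) ht, euclNorm_mulVec (transpose_mem (r.Rd_mem t ht))]

theorem navFun_nonneg (hk : 0 < k) (ht : 0 ≤ t) (hR : s.R ∈ specialOrthogonalGroup (Fin 3) ℝ) :
    0 ≤ navFun r (scalarGains P k) t s := by
  rw [navFun_eq]
  have := trace_le_three (relAtt_mem (r := r) ht hR)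
  exact mul_nonneg (by positivity) (by linarith)

/-- This is `sin² θ = (1 - cos θ)(1 + cos θ)` scaled by `k²`. The next two lemmas read off the upper
bound, and the lower bound valid up to a right angle. -/
theorem bodyErr_sq (ht : 0 ≤ t) (hR : s.R ∈ specialOrthogonalGroup (Fin 3) ℝ) :
    bodyErr r k t s ⬝ᵥ bodyErr r k t s =
      navFun r (scalarGains P k) t s * (2 * k - navFun r (scalarGains P k) t s) := by
  rw [bodyErr, smul_dotProduct, dotProduct_smul, vee_skewPart_sq (relAtt_mem ht hR), navFun_eq]
  simp only [smul_eq_mul]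
  ring

theorem bodyErr_sq_le (ht : 0 ≤ t) (hR : s.R ∈ specialOrthogonalGroup (Fin 3) ℝ) :
    bodyErr r k t s ⬝ᵥ bodyErr r k t s ≤ 2 * k * navFun r (scalarGains P k) t s := by
  rw [bodyErr_sq (P := P) ht hR]
  nlinarith [sq_nonneg (navFun r (scalarGains P k) t s)]

theorem mul_navFun_le (hk : 0 < k) (ht : 0 ≤ t) (hR : s.R ∈ specialOrthogonalGroup (Fin 3) ℝ)
    (h : navFun r (scalarGains P k) t s ≤ k) :
    k * navFun r (scalarGains P k) t s ≤ bodyErr r k t s ⬝ᵥ bodyErr r k t s := by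
  rw [bodyErr_sq (P := P) ht hR]
  nlinarith [navFun_nonneg (P := P) (r := r) hk ht hR]

theorem mulVec_controlForce (K : Gains) : s.R *ᵥ controlForce P r K t s =
    scaling K (navFun r K t s) • (attErr r t s *ᵥ desiredForce P r K t s) := by
  rw [controlForce, mulVec_smul, mulVec_mulVec, attErr]

/-- With `a = Ψ/(2k)`, the defect is `(1 - a)(R_e f - f) - a f`. The rotation contributes at most
`8a‖f‖²` to the square and the scaling `a²‖f‖² ≤ a‖f‖²`; doubling both gives `18a = 9Ψ/k`. -/
theorem forceDefect_sq_le (hk : 0 < k) (ht : 0 ≤ t)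
    (hR : s.R ∈ specialOrthogonalGroup (Fin 3) ℝ) (h : navFun r (scalarGains P k) t s ≤ k) :
    forceDefect P r (scalarGains P k) t s ⬝ᵥ forceDefect P r (scalarGains P k) t s ≤
      9 / k * navFun r (scalarGains P k) t s *
        (desiredForce P r (scalarGains P k) t s ⬝ᵥ desiredForce P r (scalarGains P k) t s) := by
  rw [forceDefect, mulVec_controlForce]
  have hA := mulVec_sub_self_sq_le (attErr_mem (r := r) ht hR)
    (desiredForce P r (scalarGains P k) t s)
  have hT : 3 - (attErr r t s).trace = 2 / k * navFun r (scalarGains P k) t s := by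
    rw [navFun_eq, trace_attErr]; field_simp
  rw [hT] at hA
  have h0 := navFun_nonneg (P := P) (r := r) hk ht hR
  generalize navFun r (scalarGains P k) t s = p at *
  generalize desiredForce P r (scalarGains P k) t s = f at *
  generalize attErr r t s *ᵥ f = g at *
  have hc : scaling (scalarGains P k) p = 1 - p / (2 * k) := by
    simp only [scaling, scalarGains]; field_simp
  rw [hc]
  set a := p / (2 * k) with ha
  have ha0 : 0 ≤ a := by positivity
  have ha1 : a ≤ 1 / 2 := by rw [ha, div_le_iff₀ (by positivity)]; linarith
  have hff := dot_self_nonneg f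
  have hp : 9 / k * p = 18 * a := by rw [ha]; field_simp; ring
  have hp' : 2 / k * p = 4 * a := by rw [ha]; field_simp; ring
  rw [hp]; rw [hp'] at hA
  have key : ((1 - a) • g - f) ⬝ᵥ ((1 - a) • g - f) ≤
      2 * (1 - a) ^ 2 * ((g - f) ⬝ᵥ (g - f)) + 2 * a ^ 2 * (f ⬝ᵥ f) := by
    have := dot_self_nonneg ((1 - a) • (g - f) + a • f)
    simp only [dotProduct_sub, sub_dotProduct, smul_dotProduct, dotProduct_smul, dotProduct_add,
      add_dotProduct, smul_eq_mul, dotProduct_comm g f] at this ⊢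
    nlinarith
  have h2 : (1 - a) ^ 2 ≤ 1 := by nlinarith
  have h3 : a ^ 2 ≤ a := by nlinarith
  have hgf := dot_self_nonneg (g - f)
  have h4 : (1 - a) ^ 2 * ((g - f) ⬝ᵥ (g - f)) ≤ (g - f) ⬝ᵥ (g - f) := by nlinarith
  have h5 : a ^ 2 * (f ⬝ᵥ f) ≤ a * (f ⬝ᵥ f) := by nlinarith
  nlinarith

theorem desiredForce_scalarGains : desiredForce P r (scalarGains P k) t s =
    -((P.m / 4) • errX r t s + (P.m / 2) • errV r t s) +
      ((P.m * P.g) • e3 + P.m • r.ad t) := by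
  simp only [desiredForce, scalarGains, smul_mulVec, one_mulVec, smul_add, smul_smul]
  abel

theorem lyapX_scalarGains : lyapX P r (scalarGains P k) t s (P.m / 4) =
    P.m / 2 * (errV r t s ⬝ᵥ errV r t s) + P.m / 8 * (errX r t s ⬝ᵥ errX r t s) +
      P.m / 4 * (errX r t s ⬝ᵥ errV r t s) := by
  simp only [lyapX, scalarGains, smul_mulVec, one_mulVec, dotProduct_smul, smul_eq_mul]
  ring

end Static

/-! ### Error dynamics for arbitrary gains. -/

section Dynamics

variable {P : Body} {r : Reference} {K : Gains} {S : Set ℝ} {s : ℝ → State} {t : ℝ}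

theorem IsMotionOn.errX_deriv (h : IsMotionOn P r K S s) (hS : S ⊆ Set.Ici 0) (ht : t ∈ S) :
    HasDerivWithinAt (fun u => errX r u (s u)) (errV r t (s t)) S t :=
  (h.x_deriv t ht).sub ((r.xd_deriv t (hS ht)).mono hS)

/-- The derivative is split so that the reference rotation enters only through a commutator, which
is invisible to the trace and acts on the error vector as a cross product. -/
theorem IsMotionOn.relAtt_deriv (h : IsMotionOn P r K S s) (hS : S ⊆ Set.Ici 0) (ht : t ∈ S) :
    HasDerivWithinAt (fun u => relAtt r u (s u))
      (relAtt r t (s t) * hat (errW r t (s t)) +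
        (relAtt r t (s t) * hat (r.wd t) - hat (r.wd t) * relAtt r t (s t))) S t := by
  have h1 := hasDerivWithinAt_matMul
    (hasDerivWithinAt_transpose (hasDerivWithinAt_mat_mono (r.Rd_deriv t (hS ht)) hS)) (h.R_deriv t ht)
  change HasDerivWithinAt (fun u => (r.Rd u)ᵀ * (s u).R) _ S t
  convert h1 using 1
  have hskew : (hat (r.wd t))ᵀ = -hat (r.wd t) := by
    ext i j; fin_cases i <;> fin_cases j <;> simp [hat]
  have hadd : hat (errW r t (s t)) = hat (s t).w - hat (r.wd t) := by
    ext i j; fin_cases i <;> fin_cases j <;> simp [hat, errW] <;> ring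
  rw [transpose_mul, hskew, hadd, relAtt]
  noncomm_ring

/-- The feedforward torque cancels `J ω_d'` and turns the gyroscopic term into one orthogonal to
`e_ω`, which therefore does no work on the error. -/
theorem IsMotionOn.momentum_deriv (h : IsMotionOn P r K S s) (hS : S ⊆ Set.Ici 0) (ht : t ∈ S) :
    HasDerivWithinAt (fun u => P.J *ᵥ errW r u (s u))
      (-(errW r t (s t) ⨯₃ (P.J *ᵥ (s t).w)) - (r.Rd t)ᵀ *ᵥ errR r K t (s t) -
        K.Kw *ᵥ errW r t (s t)) S t := by
  have h1 := (h.w_deriv t ht).sub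
    (hasDerivWithinAt_const_mulVec P.J ((r.wd_deriv t (hS ht)).mono hS))
  refine (h1.congr_deriv ?_).congr_of_eventuallyEq (.of_forall fun u => ?_) ?_
  · simp only [controlTorque, errW, map_sub, LinearMap.sub_apply]
    abel
  · simp [errW, mulVec_sub]
  · simp [errW, mulVec_sub]

theorem IsMotionOn.errW_deriv (h : IsMotionOn P r K S s) (hS : S ⊆ Set.Ici 0) (ht : t ∈ S) :
    HasDerivWithinAt (fun u => errW r u (s u))
      (P.J⁻¹ *ᵥ (-(errW r t (s t) ⨯₃ (P.J *ᵥ (s t).w)) - (r.Rd t)ᵀ *ᵥ errR r K t (s t) -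
        K.Kw *ᵥ errW r t (s t))) S t := by
  have h1 := hasDerivWithinAt_const_mulVec P.J⁻¹ (h.momentum_deriv hS ht)
  have hJ : P.J⁻¹ * P.J = 1 := nonsing_inv_mul _ ((isUnit_iff_isUnit_det _).mp P.J_posDef.isUnit)
  simpa only [mulVec_mulVec, hJ, one_mulVec] using h1

theorem IsMotionOn.errV_deriv (h : IsMotionOn P r K S s) (hS : S ⊆ Set.Ici 0) (ht : t ∈ S) :
    HasDerivWithinAt (fun u => errV r u (s u))
      (P.m⁻¹ • (-(K.Kx *ᵥ errX r t (s t)) - K.Kv *ᵥ errV r t (s t) +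
        forceDefect P r K t (s t))) S t := by
  have hm := P.m_pos.ne'
  have h1 := ((h.v_deriv t ht).const_smul P.m⁻¹).sub ((r.vd_deriv t (hS ht)).mono hS)
  refine (h1.congr_deriv ?_).congr_of_eventuallyEq (.of_forall fun u => ?_) ?_
  · have : r.ad t = P.m⁻¹ • (P.m • r.ad t) := by rw [smul_smul, inv_mul_cancel₀ hm, one_smul]
    conv_lhs => rw [this]
    rw [← smul_sub, forceDefect]
    congr 1
    simp only [desiredForce, smul_add, smul_smul]
    abel
  · simp [errV, smul_smul, inv_mul_cancel₀ hm]
  · simp [errV, smul_smul, inv_mul_cancel₀ hm]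

end Dynamics

/-! ### Derivatives of the energy functions for scalar gains. -/

section ScalarDynamics

variable {P : Body} {r : Reference} {k : ℝ} {S : Set ℝ} {s : ℝ → State} {t : ℝ}

theorem IsMotionOn.navFun_deriv (h : IsMotionOn P r (scalarGains P k) S s)
    (hS : S ⊆ Set.Ici 0) (ht : t ∈ S) :
    HasDerivWithinAt (fun u => navFun r (scalarGains P k) u (s u))
      (bodyErr r k t (s t) ⬝ᵥ errW r t (s t)) S t := by
  have h1 := ((hasDerivWithinAt_trace (h.relAtt_deriv hS ht)).const_sub 3).const_mul (k / 2)
  simp only [← navFun_eq (P := P)] at h1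
  refine h1.congr_deriv ?_
  rw [trace_add, trace_sub, Matrix.trace_mul_comm _ (hat (r.wd t)), trace_mul_hat, bodyErr,
    smul_dotProduct, smul_eq_mul]
  ring

theorem IsMotionOn.bodyErr_deriv (h : IsMotionOn P r (scalarGains P k) S s)
    (hS : S ⊆ Set.Ici 0) (ht : t ∈ S) :
    HasDerivWithinAt (fun u => bodyErr r k u (s u))
      (k • vee (skewPart (relAtt r t (s t) * hat (errW r t (s t)))) +
        bodyErr r k t (s t) ⨯₃ r.wd t) S t := by
  have h1 := (hasDerivWithinAt_vee_skewPart (h.relAtt_deriv hS ht)).const_smul k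
  refine h1.congr_deriv ?_
  have hadd : ∀ M N : Mat3, vee (skewPart (M + N)) = vee (skewPart M) + vee (skewPart N) := by
    intro M N; ext i; fin_cases i <;> simp [vee, skewPart] <;> ring
  rw [hadd, vee_skewPart_commutator, smul_add, bodyErr, map_smul, LinearMap.smul_apply]

/-- The power of the restoring torque cancels the derivative of `Ψ` and the gyroscopic term does no
work; only the damping `Kw = 1` remains. -/
theorem IsMotionOn.attEnergy_deriv (h : IsMotionOn P r (scalarGains P k) S s)
    (hS : S ⊆ Set.Ici 0) (ht : t ∈ S) :
    HasDerivWithinAt (fun u => attEnergy P r (scalarGains P k) u (s u))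
      (-(errW r t (s t) ⬝ᵥ errW r t (s t))) S t := by
  have h1 := ((hasDerivWithinAt_dot (h.errW_deriv hS ht) (h.momentum_deriv hS ht)).const_mul
    (1 / 2)).add (h.navFun_deriv hS ht)
  refine h1.congr_deriv ?_
  have hsymm : P.Jᵀ = P.J := P.J_posDef.isHermitian
  have hJ : P.J * P.J⁻¹ = 1 := mul_nonsing_inv _ ((isUnit_iff_isUnit_det _).mp P.J_posDef.isUnit)
  rw [dotProduct_mulVec, ← mulVec_transpose, hsymm, mulVec_mulVec, hJ, one_mulVec,
    transpose_mulVec_errR (hS ht), dotProduct_comm _ (errW r t (s t))]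
  simp only [dotProduct_sub, dotProduct_neg, dot_self_cross, scalarGains, one_mulVec,
    dotProduct_comm (bodyErr r k t (s t))]
  ring

theorem IsMotionOn.lyapX_deriv (h : IsMotionOn P r (scalarGains P k) S s)
    (hS : S ⊆ Set.Ici 0) (ht : t ∈ S) :
    HasDerivWithinAt (fun u => lyapX P r (scalarGains P k) u (s u) (P.m / 4))
      (-(1 / 2) * lyapX P r (scalarGains P k) t (s t) (P.m / 4) +
        (errV r t (s t) + (1 / 4 : ℝ) • errX r t (s t)) ⬝ᵥ
          forceDefect P r (scalarGains P k) t (s t)) S t := by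
  have hx := h.errX_deriv hS ht
  have hv := h.errV_deriv hS ht
  have h1 := (((hasDerivWithinAt_dot hv hv).const_mul (P.m / 2)).add
    ((hasDerivWithinAt_dot hx hx).const_mul (P.m / 8))).add
    ((hasDerivWithinAt_dot hx hv).const_mul (P.m / 4))
  simp only [lyapX_scalarGains]
  refine h1.congr_deriv ?_
  have hm := P.m_pos.ne'
  simp only [scalarGains, smul_mulVec, one_mulVec, dotProduct_add, add_dotProduct, dotProduct_sub,
    sub_dotProduct, dotProduct_neg, neg_dotProduct, dotProduct_smul, smul_dotProduct, smul_eq_mul,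
    dotProduct_comm (errV r t (s t)) (errX r t (s t)),
    dotProduct_comm (forceDefect P r _ t (s t))]
  field_simp
  ring

end ScalarDynamics

/-! ### Translational Lyapunov function -/

section Translation

variable {P : Body} {r : Reference} {k t t₀ T ψ fMd fcM : ℝ} {s₀ : State} {s : ℝ → State}

theorem navFun_le_attEnergy (K : Gains) :
    navFun r K t s₀ ≤ attEnergy P r K t s₀ := by
  obtain ⟨c, hc, h⟩ := PosDef.exists_le_dot P.J_posDef
  have h1 := h (errW r t s₀)
  have h2 := mul_nonneg hc.le (dot_self_nonneg (errW r t s₀))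
  rw [attEnergy]
  linarith

theorem IsMotionOn.attEnergy_le (h : IsMotionOn P r (scalarGains P k) (Set.Icc t₀ T) s)
    (ht₀ : 0 ≤ t₀) (ht : t ∈ Set.Icc t₀ T) :
    attEnergy P r (scalarGains P k) t (s t) ≤ attEnergy P r (scalarGains P k) t₀ (s t₀) := by
  have hS : Set.Icc t₀ T ⊆ Set.Ici 0 := fun u hu => ht₀.trans hu.1
  -- Rate zero in the comparison lemma is plain monotonicity.
  have := le_exp_mul_of_deriv_le (c := 0) (fun u hu => h.attEnergy_deriv hS hu)
    (fun u hu => by linarith [dot_self_nonneg (errW r u (s u))]) t ht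
  simpa using this

theorem le_lyapX : P.m / 16 * (errX r t s₀ ⬝ᵥ errX r t s₀ + errV r t s₀ ⬝ᵥ errV r t s₀) ≤
    lyapX P r (scalarGains P k) t s₀ (P.m / 4) := by
  rw [lyapX_scalarGains]
  have h1 := dot_self_nonneg (errX r t s₀ + (2 : ℝ) • errV r t s₀)
  have h2 := dot_self_nonneg (errV r t s₀)
  simp only [dotProduct_add, add_dotProduct, dotProduct_smul, smul_dotProduct, smul_eq_mul,
    dotProduct_comm (errV r t s₀) (errX r t s₀)] at h1
  have := mul_nonneg P.m_pos.le h1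
  have := mul_nonneg P.m_pos.le h2
  nlinarith

theorem lyapX_le : lyapX P r (scalarGains P k) t s₀ (P.m / 4) ≤
    P.m * (errX r t s₀ ⬝ᵥ errX r t s₀ + errV r t s₀ ⬝ᵥ errV r t s₀) := by
  rw [lyapX_scalarGains]
  have h1 := dot_self_nonneg (errX r t s₀ - errV r t s₀)
  have h2 := dot_self_nonneg (errV r t s₀)
  have h3 := dot_self_nonneg (errX r t s₀)
  simp only [dotProduct_sub, sub_dotProduct,
    dotProduct_comm (errV r t s₀) (errX r t s₀)] at h1
  have := mul_nonneg P.m_pos.le h1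
  have := mul_nonneg P.m_pos.le h2
  have := mul_nonneg P.m_pos.le h3
  nlinarith

/-- The difference of the two sides is the square `(m²/48) ‖e_x - 2 e_v‖²`. -/
theorem feedback_sq_le : ((P.m / 4) • errX r t s₀ + (P.m / 2) • errV r t s₀) ⬝ᵥ
    ((P.m / 4) • errX r t s₀ + (P.m / 2) • errV r t s₀) ≤
    2 / 3 * P.m * lyapX P r (scalarGains P k) t s₀ (P.m / 4) := by
  rw [lyapX_scalarGains]
  have h1 := dot_self_nonneg (errX r t s₀ - (2 : ℝ) • errV r t s₀)
  simp only [dotProduct_add, add_dotProduct, dotProduct_smul, smul_dotProduct, smul_eq_mul,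
    dotProduct_comm (errV r t s₀) (errX r t s₀), dotProduct_sub, sub_dotProduct] at h1 ⊢
  have := mul_nonneg (sq_nonneg P.m) h1
  nlinarith

/-- Young's inequality `w ⬝ᵥ d ≤ (m/8)‖w‖² + (2/m)‖d‖²` with `w = e_v + e_x/4`, where `(m/8)‖w‖² ≤
V_x/4`. -/
theorem lyapX_rate_le {d : Vec3} :
    -(1 / 2) * lyapX P r (scalarGains P k) t s₀ (P.m / 4) +
      (errV r t s₀ + (1 / 4 : ℝ) • errX r t s₀) ⬝ᵥ d ≤
    -(1 / 4) * lyapX P r (scalarGains P k) t s₀ (P.m / 4) + 2 / P.m * (d ⬝ᵥ d) := by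
  rw [lyapX_scalarGains]
  have hm := P.m_pos
  have h1 := dot_self_nonneg
    (P.m • (errV r t s₀ + (1 / 4 : ℝ) • errX r t s₀) - (4 : ℝ) • d)
  have h2 := mul_nonneg hm.le (dot_self_nonneg (errX r t s₀))
  simp only [dotProduct_add, add_dotProduct, dotProduct_smul, smul_dotProduct, smul_eq_mul,
    dotProduct_comm (errV r t s₀) (errX r t s₀), dotProduct_sub, sub_dotProduct,
    dotProduct_comm d] at h1 ⊢
  set a := errX r t s₀ ⬝ᵥ errX r t s₀
  set b := errX r t s₀ ⬝ᵥ errV r t s₀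
  set c := errV r t s₀ ⬝ᵥ errV r t s₀
  set e := errV r t s₀ ⬝ᵥ d
  set f := errX r t s₀ ⬝ᵥ d
  set g := d ⬝ᵥ d
  have h3 : 0 ≤ (1 / (8 * P.m)) * (P.m * (P.m * (c + 1 / 4 * b) + 1 / 4 * (P.m * (b + 1 / 4 * a)))
      - 8 * P.m * (e + 1 / 4 * f) + 16 * g) := mul_nonneg (by positivity) (by linarith)
  have h4 : (1 / (8 * P.m)) * (P.m * (P.m * (c + 1 / 4 * b) + 1 / 4 * (P.m * (b + 1 / 4 * a)))
      - 8 * P.m * (e + 1 / 4 * f) + 16 * g) =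
      P.m / 8 * (c + 1 / 2 * b + 1 / 16 * a) - (e + 1 / 4 * f) + 2 / P.m * g := by
    field_simp; ring
  rw [h4] at h3
  linarith

theorem desiredForce_sq_le (hF : euclNorm ((P.m * P.g) • e3 + P.m • r.ad t) ≤ fMd) :
    desiredForce P r (scalarGains P k) t s₀ ⬝ᵥ desiredForce P r (scalarGains P k) t s₀ ≤
      4 / 3 * P.m * lyapX P r (scalarGains P k) t s₀ (P.m / 4) + 2 * fMd ^ 2 := by
  rw [desiredForce_scalarGains]
  have h1 := feedback_sq_le (P := P) (r := r) (k := k) (t := t) (s₀ := s₀)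
  have h2 : ((P.m * P.g) • e3 + P.m • r.ad t) ⬝ᵥ ((P.m * P.g) • e3 + P.m • r.ad t) ≤ fMd ^ 2 := by
    rw [← euclNorm_sq]
    exact pow_le_pow_left₀ (euclNorm_nonneg _) hF 2
  generalize (P.m * P.g) • e3 + P.m • r.ad t = F at *
  generalize (P.m / 4) • errX r t s₀ + (P.m / 2) • errV r t s₀ = u at *
  have h3 := dot_self_nonneg (u + F)
  simp only [dotProduct_add, add_dotProduct, dotProduct_neg, neg_dotProduct,
    dotProduct_comm F u] at h3 ⊢
  linarith

/-- Forward invariance of the region of attraction. -/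
theorem IsMotionOn.lyapX_le_level (h : IsMotionOn P r (scalarGains P k) (Set.Icc t₀ T) s)
    (ht₀ : 0 ≤ t₀) (hψ : 0 < ψ) (hk : 192 * ψ ≤ k) (hk' : 576 * ψ * fMd ^ 2 ≤ k * fcM ^ 2)
    (hF : ∀ t, 0 ≤ t → euclNorm ((P.m * P.g) • e3 + P.m • r.ad t) ≤ fMd)
    (hE : attEnergy P r (scalarGains P k) t₀ (s t₀) < ψ)
    (hV : lyapX P r (scalarGains P k) t₀ (s t₀) (P.m / 4) ≤ fcM ^ 2 / (2 * P.m))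
    (ht : t ∈ Set.Icc t₀ T) :
    lyapX P r (scalarGains P k) t (s t) (P.m / 4) ≤ fcM ^ 2 / (2 * P.m) := by
  have hS : Set.Icc t₀ T ⊆ Set.Ici 0 := fun u hu => ht₀.trans hu.1
  have hm := P.m_pos
  have hk0 : 0 < k := by linarith
  -- The comparison is applied to the excess of `V_x` over the level. Half of the decay rate `1/4`
  -- absorbs the part of the disturbance proportional to `V_x`; the other half, at the level,
  -- absorbs the constant part.
  have := le_exp_mul_of_deriv_le (c := 1 / 8)
    (fun u hu => (h.lyapX_deriv hS hu).sub_const (fcM ^ 2 / (2 * P.m))) (fun u hu => ?_) t ht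
  · have h2 := mul_nonpos_of_nonneg_of_nonpos (Real.exp_pos (-(1 / 8) * (t - t₀))).le
      (sub_nonpos.mpr hV)
    linarith
  · refine lyapX_rate_le.trans ?_
    have hN : navFun r (scalarGains P k) u (s u) ≤ ψ :=
      (navFun_le_attEnergy (P := P) _).trans ((h.attEnergy_le ht₀ hu).trans hE.le)
    have hd := forceDefect_sq_le (P := P) hk0 (hS hu) (h.R_mem u hu) (hN.trans (by linarith))
    have hf := desiredForce_sq_le (k := k) (s₀ := s u) (hF u (hS hu))
    have hV0 : 0 ≤ lyapX P r (scalarGains P k) u (s u) (P.m / 4) :=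
      le_trans (mul_nonneg (by positivity) (add_nonneg (dot_self_nonneg _) (dot_self_nonneg _)))
        le_lyapX
    have hf0 := dot_self_nonneg (desiredForce P r (scalarGains P k) u (s u))
    generalize lyapX P r (scalarGains P k) u (s u) (P.m / 4) = V at *
    generalize forceDefect P r (scalarGains P k) u (s u) ⬝ᵥ
      forceDefect P r (scalarGains P k) u (s u) = d at *
    generalize desiredForce P r (scalarGains P k) u (s u) ⬝ᵥ
      desiredForce P r (scalarGains P k) u (s u) = f at *
    have h1 : d ≤ 9 / k * ψ * (4 / 3 * P.m * V + 2 * fMd ^ 2) :=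
      hd.trans (by gcongr)
    have h2 : 2 / P.m * d ≤ 24 * ψ / k * V + 36 * ψ * fMd ^ 2 / (P.m * k) := by
      calc 2 / P.m * d ≤ 2 / P.m * (9 / k * ψ * (4 / 3 * P.m * V + 2 * fMd ^ 2)) := by gcongr
        _ = _ := by field_simp; ring
    -- The two lower bounds on `k` originate here: `192 = 24 * 8`, and `576 = 36 * 16` in the next
    -- estimate.
    have h3 : 24 * ψ / k ≤ 1 / 8 := by rw [div_le_iff₀ hk0]; linarith
    have h4 : 36 * ψ * fMd ^ 2 / (P.m * k) ≤ 1 / 8 * (fcM ^ 2 / (2 * P.m)) := by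
      rw [div_le_iff₀ (by positivity)]
      calc 36 * ψ * fMd ^ 2 ≤ k * fcM ^ 2 / 16 := by linarith
        _ = _ := by field_simp; ring
    have h5 := mul_le_mul_of_nonneg_right h3 hV0
    linarith

theorem controlForce_le {D : ℝ} (hk : 0 < k) (ht : 0 ≤ t)
    (hR : s₀.R ∈ specialOrthogonalGroup (Fin 3) ℝ) (h : navFun r (scalarGains P k) t s₀ ≤ k)
    (hD : euclNorm (desiredForce P r (scalarGains P k) t s₀) ≤ D) :
    euclNorm (controlForce P r (scalarGains P k) t s₀) ≤ D := by
  rw [controlForce, euclNorm_smul, euclNorm_mulVec (transpose_mem (r.Rd_mem t ht))]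
  have h0 := navFun_nonneg (P := P) (r := r) hk ht hR
  have hc : |scaling (scalarGains P k) (navFun r (scalarGains P k) t s₀)| ≤ 1 := by
    simp only [scaling, scalarGains] at h h0 ⊢
    rw [abs_le]
    constructor
    · rw [le_div_iff₀ (by positivity)]; linarith
    · rw [div_le_iff₀ (by positivity)]; linarith
  calc _ ≤ 1 * euclNorm (desiredForce P r (scalarGains P k) t s₀) :=
        mul_le_mul_of_nonneg_right hc (euclNorm_nonneg _)
    _ ≤ D := by rwa [one_mul]

theorem desiredForce_le (hfcM : 0 ≤ fcM)
    (hF : euclNorm ((P.m * P.g) • e3 + P.m • r.ad t) ≤ fMd)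
    (hV : lyapX P r (scalarGains P k) t s₀ (P.m / 4) ≤ fcM ^ 2 / (2 * P.m)) :
    euclNorm (desiredForce P r (scalarGains P k) t s₀) ≤ fcM + fMd := by
  rw [desiredForce_scalarGains]
  refine (euclNorm_add_le _ _).trans (add_le_add ?_ hF)
  rw [euclNorm_neg]
  refine euclNorm_le_of_dot_le hfcM ((feedback_sq_le (k := k)).trans ?_)
  have hm := P.m_pos
  calc _ ≤ 2 / 3 * P.m * (fcM ^ 2 / (2 * P.m)) := by gcongr
    _ = fcM ^ 2 / 3 := by field_simp
    _ ≤ fcM ^ 2 := by linarith [sq_nonneg fcM]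

/-- The scaling is strictly positive because `Ψ ≤ k < 2k`, and `R_dᵀ` carries the axis `R_d e₃` to
`e₃`, so the angle to the axis is unchanged. -/
theorem inCone_controlForce {θ : ℝ} (hk : 0 < k) (ht : 0 ≤ t)
    (h : navFun r (scalarGains P k) t s₀ ≤ k)
    (hc : InCone θ (r.Rd t *ᵥ e3) (desiredForce P r (scalarGains P k) t s₀)) :
    InCone θ e3 (controlForce P r (scalarGains P k) t s₀) := by
  obtain ⟨hne, hc⟩ := hc
  have hpos : 0 < scaling (scalarGains P k) (navFun r (scalarGains P k) t s₀) := by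
    simp only [scaling, scalarGains] at h ⊢
    exact div_pos (by linarith) (by linarith)
  have hQ := transpose_mem (r.Rd_mem t ht)
  rw [controlForce]
  generalize scaling (scalarGains P k) (navFun r (scalarGains P k) t s₀) = c at *
  generalize desiredForce P r (scalarGains P k) t s₀ = f at *
  refine ⟨smul_ne_zero hpos.ne' fun h0 => hne ?_, ?_⟩
  · have := congrArg (fun u => r.Rd t *ᵥ u) h0
    simpa [mulVec_mulVec, mul_transpose_self_of_mem (r.Rd_mem t ht)] using this
  · rw [euclNorm_smul, euclNorm_mulVec hQ, abs_of_pos hpos, smul_dotProduct, smul_eq_mul,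
      mul_div_mul_left _ _ hpos.ne', mulVec_transpose, ← dotProduct_mulVec]
    exact hc

end Translation

/-! ### Rotational Lyapunov function -/

/-- The attitude energy with a cross term between angular momentum and attitude error. -/
def rotLyap (P : Body) (r : Reference) (k q t : ℝ) (s : State) : ℝ :=
  attEnergy P r (scalarGains P k) t s + q * ((P.J *ᵥ errW r t s) ⬝ᵥ bodyErr r k t s)

/-- The derivative of `rotLyap` along the closed loop. -/
def rotLyapRate (P : Body) (r : Reference) (k q t : ℝ) (s : State) : ℝ :=
  -(errW r t s ⬝ᵥ errW r t s) +
    q * ((-(errW r t s ⨯₃ (P.J *ᵥ s.w)) - bodyErr r k t s - errW r t s) ⬝ᵥ bodyErr r k t s +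
      (P.J *ᵥ errW r t s) ⬝ᵥ (k • vee (skewPart (relAtt r t s * hat (errW r t s))) +
        bodyErr r k t s ⨯₃ r.wd t))

section Rotation

variable {P : Body} {r : Reference} {k q t B Λ : ℝ} {S : Set ℝ} {s₀ : State} {s : ℝ → State}

theorem IsMotionOn.rotLyap_deriv (h : IsMotionOn P r (scalarGains P k) S s)
    (hS : S ⊆ Set.Ici 0) (ht : t ∈ S) :
    HasDerivWithinAt (fun u => rotLyap P r k q u (s u)) (rotLyapRate P r k q t (s t)) S t := by
  have h1 := (h.attEnergy_deriv hS ht).add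
    ((hasDerivWithinAt_dot (h.momentum_deriv hS ht) (h.bodyErr_deriv hS ht)).const_mul q)
  refine h1.congr_deriv ?_
  rw [transpose_mulVec_errR (hS ht)]
  simp only [rotLyapRate, scalarGains, one_mulVec]

/-- Differentiating the cross term produces the missing `-q‖e_R‖²`. All other new terms are at most
multiples of `‖e_ω‖²` and of `‖e_ω‖‖e_R‖`; Young's inequality spends half of `q‖e_R‖²`, and the
smallness of `q` spends half of the damping. -/
theorem rotLyapRate_le (hk : 0 < k) (ht : 0 ≤ t) (hq : 0 < q)
    (hR : s₀.R ∈ specialOrthogonalGroup (Fin 3) ℝ) (hN : navFun r (scalarGains P k) t s₀ ≤ k)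
    (hB : euclNorm (r.wd t) ≤ B) (hΛ0 : 0 ≤ Λ)
    (hΛ : ∀ u, euclNorm (P.J *ᵥ u) ≤ Λ * euclNorm u)
    (hq' : q * (3 * Λ * k + (2 * Λ * B + 1) ^ 2 / 2) ≤ 1 / 2) :
    rotLyapRate P r k q t s₀ ≤
      -(1 / 2) * euclNorm (errW r t s₀) ^ 2 - q / 2 * euclNorm (bodyErr r k t s₀) ^ 2 := by
  -- This crude bound lowers the cubic gyroscopic term to a quadratic one.
  have hY : euclNorm (bodyErr r k t s₀) ≤ 2 * k := by
    refine euclNorm_le_of_dot_le (by positivity) ((bodyErr_sq_le (P := P) ht hR).trans ?_)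
    nlinarith
  have hz := euclNorm_vee_skewPart_mul_hat_le (relAtt_mem (r := r) ht hR) (errW r t s₀)
  have hw : s₀.w = errW r t s₀ + r.wd t := by simp [errW]
  rw [rotLyapRate, hw]
  generalize bodyErr r k t s₀ = y at *
  generalize vee (skewPart (relAtt r t s₀ * hat (errW r t s₀))) = z at *
  generalize errW r t s₀ = e at *
  generalize r.wd t = d at *
  have he0 := euclNorm_nonneg e
  have hy0 := euclNorm_nonneg y
  have hd0 := euclNorm_nonneg d
  have hJe := hΛ e
  have hJd := hΛ d
  have t1 : -((e ⨯₃ (P.J *ᵥ e)) ⬝ᵥ y) ≤ 2 * Λ * k * euclNorm e ^ 2 := by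
    calc _ ≤ euclNorm (e ⨯₃ (P.J *ᵥ e)) * euclNorm y := neg_dot_le _ _
      _ ≤ (euclNorm e * (Λ * euclNorm e)) * (2 * k) := by
        gcongr
        exact (euclNorm_cross_le _ _).trans (by gcongr)
      _ = _ := by ring
  have t2 : -((e ⨯₃ (P.J *ᵥ d)) ⬝ᵥ y) ≤ Λ * B * (euclNorm e * euclNorm y) := by
    calc _ ≤ euclNorm (e ⨯₃ (P.J *ᵥ d)) * euclNorm y := neg_dot_le _ _
      _ ≤ (euclNorm e * (Λ * B)) * euclNorm y := by
        gcongr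
        refine (euclNorm_cross_le _ _).trans ?_
        gcongr
        exact hJd.trans (by gcongr)
      _ = _ := by ring
  have t3 : -(e ⬝ᵥ y) ≤ euclNorm e * euclNorm y := neg_dot_le _ _
  have t4 : (P.J *ᵥ e) ⬝ᵥ z ≤ Λ * euclNorm e ^ 2 := by
    calc _ ≤ euclNorm (P.J *ᵥ e) * euclNorm z := dot_le _ _
      _ ≤ (Λ * euclNorm e) * euclNorm e := by
        gcongr
        exact euclNorm_nonneg _
      _ = _ := by ring
  have t5 : (P.J *ᵥ e) ⬝ᵥ (y ⨯₃ d) ≤ Λ * B * (euclNorm e * euclNorm y) := by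
    calc _ ≤ euclNorm (P.J *ᵥ e) * euclNorm (y ⨯₃ d) := dot_le _ _
      _ ≤ (Λ * euclNorm e) * (euclNorm y * B) := by
        gcongr
        · exact euclNorm_nonneg _
        · exact (euclNorm_cross_le _ _).trans (by gcongr)
      _ = _ := by ring
  have hsplit : (-(e ⨯₃ (P.J *ᵥ (e + d))) - y - e) ⬝ᵥ y + (P.J *ᵥ e) ⬝ᵥ (k • z + y ⨯₃ d) =
      -((e ⨯₃ (P.J *ᵥ e)) ⬝ᵥ y) + -((e ⨯₃ (P.J *ᵥ d)) ⬝ᵥ y) - euclNorm y ^ 2 + -(e ⬝ᵥ y) +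
        k * ((P.J *ᵥ e) ⬝ᵥ z) + (P.J *ᵥ e) ⬝ᵥ (y ⨯₃ d) := by
    rw [euclNorm_sq]
    simp only [mulVec_add, map_add, sub_dotProduct, neg_dotProduct, add_dotProduct,
      dotProduct_add, dotProduct_smul, smul_eq_mul]
    ring
  rw [hsplit, ← euclNorm_sq e]
  generalize euclNorm e = W at *
  generalize euclNorm y = Y at *
  have t6 : -((e ⨯₃ (P.J *ᵥ e)) ⬝ᵥ y) + -((e ⨯₃ (P.J *ᵥ d)) ⬝ᵥ y) - Y ^ 2 + -(e ⬝ᵥ y) +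
        k * ((P.J *ᵥ e) ⬝ᵥ z) + (P.J *ᵥ e) ⬝ᵥ (y ⨯₃ d) ≤
      (3 * Λ * k + (2 * Λ * B + 1) ^ 2 / 2) * W ^ 2 - 1 / 2 * Y ^ 2 := by
    have h1 := mul_le_mul_of_nonneg_left t4 hk.le
    have h2 : (2 * Λ * B + 1) * (W * Y) ≤ (2 * Λ * B + 1) ^ 2 / 2 * W ^ 2 + 1 / 2 * Y ^ 2 := by
      nlinarith [sq_nonneg ((2 * Λ * B + 1) * W - Y)]
    linarith
  have h3 := mul_le_mul_of_nonneg_left t6 hq.le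
  have h4 := mul_le_mul_of_nonneg_right hq' (sq_nonneg W)
  linarith

theorem rotLyap_bounds {j : ℝ} (hk : 0 < k) (ht : 0 ≤ t) (hq : 0 < q)
    (hR : s₀.R ∈ specialOrthogonalGroup (Fin 3) ℝ) (hN : navFun r (scalarGains P k) t s₀ ≤ k)
    (hΛ : ∀ u, euclNorm (P.J *ᵥ u) ≤ Λ * euclNorm u)
    (hj : ∀ u : Vec3, j * (u ⬝ᵥ u) ≤ u ⬝ᵥ P.J *ᵥ u)
    (hq₁ : q * Λ ^ 2 ≤ j / 2) (hq₂ : q ≤ 1 / (2 * k)) :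
    j / 4 * euclNorm (errW r t s₀) ^ 2 + 1 / (4 * k) * euclNorm (bodyErr r k t s₀) ^ 2 ≤
        rotLyap P r k q t s₀ ∧
      rotLyap P r k q t s₀ ≤ (Λ / 2 + j / 4) * euclNorm (errW r t s₀) ^ 2 +
        2 / k * euclNorm (bodyErr r k t s₀) ^ 2 := by
  have h1 := bodyErr_sq_le (P := P) (r := r) (k := k) ht hR
  have h2 := mul_navFun_le (P := P) (r := r) hk ht hR hN
  rw [rotLyap, attEnergy]
  generalize navFun r (scalarGains P k) t s₀ = p at *
  generalize bodyErr r k t s₀ = y at *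
  generalize errW r t s₀ = e at *
  have hj := hj e
  have he := dot_le e (P.J *ᵥ e)
  have ha := abs_le.mp (abs_dot_le (P.J *ᵥ e) y)
  rw [← euclNorm_sq] at h1 h2 hj
  have he0 := euclNorm_nonneg e
  have hy0 := euclNorm_nonneg y
  have hJe0 := euclNorm_nonneg (P.J *ᵥ e)
  have hJe := hΛ e
  generalize (P.J *ᵥ e) ⬝ᵥ y = a at *
  generalize e ⬝ᵥ P.J *ᵥ e = b at *
  generalize euclNorm (P.J *ᵥ e) = c at *
  generalize euclNorm e = W at *
  generalize euclNorm y = Y at *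
  have h3 : c * Y ≤ 1 / 2 * (Λ * W) ^ 2 + 1 / 2 * Y ^ 2 := by
    have : c ^ 2 ≤ (Λ * W) ^ 2 := pow_le_pow_left₀ hJe0 hJe 2
    nlinarith [sq_nonneg (c - Y)]
  -- The cross term costs at most half of the lower bound `(j/2) W² + Y²/(2k)` of the energy.
  have h4 : q * (c * Y) ≤ j / 4 * W ^ 2 + 1 / (4 * k) * Y ^ 2 := by
    have e1 := mul_le_mul_of_nonneg_left h3 hq.le
    have e2 := mul_le_mul_of_nonneg_right hq₁ (sq_nonneg W)
    have e3 := mul_le_mul_of_nonneg_right hq₂ (sq_nonneg Y)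
    have e4 : 1 / (2 * k) * Y ^ 2 = 2 * (1 / (4 * k) * Y ^ 2) := by field_simp; ring
    nlinarith
  have h5 := mul_le_mul_of_nonneg_left ha.1 hq.le
  have h6 := mul_le_mul_of_nonneg_left ha.2 hq.le
  have h7 : 1 / (2 * k) * Y ^ 2 ≤ p := by
    rw [div_mul_eq_mul_div, div_le_iff₀ (by positivity)]; linarith
  have h8 : p ≤ 1 / k * Y ^ 2 := by
    rw [div_mul_eq_mul_div, le_div_iff₀ hk]; linarith
  have h9 : b ≤ Λ * W ^ 2 := he.trans (by nlinarith)
  have e4 : 1 / (2 * k) * Y ^ 2 = 2 * (1 / (4 * k) * Y ^ 2) := by field_simp; ring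
  have e5 : 1 / k * Y ^ 2 = 4 * (1 / (4 * k) * Y ^ 2) := by field_simp
  have e6 : 2 / k * Y ^ 2 = 8 * (1 / (4 * k) * Y ^ 2) := by field_simp; ring
  have e7 : 0 ≤ 1 / (4 * k) * Y ^ 2 := by positivity
  constructor <;> nlinarith

/-- For a small cross term, `rotLyap` is a strict quadratic Lyapunov function of the attitude
error dynamics, uniformly in time. -/
theorem exists_rotLyap (P : Body) (r : Reference) (hk : 0 < k)
    (hB : ∀ t, 0 ≤ t → euclNorm (r.wd t) ≤ B) :
    ∃ q a b : ℝ, 0 < q ∧ 0 < a ∧ 0 < b ∧ ∀ (t : ℝ) (s : State), 0 ≤ t →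
      s.R ∈ specialOrthogonalGroup (Fin 3) ℝ → navFun r (scalarGains P k) t s ≤ k →
      a * (euclNorm (errW r t s) ^ 2 + euclNorm (bodyErr r k t s) ^ 2) ≤ rotLyap P r k q t s ∧
      rotLyap P r k q t s ≤ b * (euclNorm (errW r t s) ^ 2 + euclNorm (bodyErr r k t s) ^ 2) ∧
      rotLyapRate P r k q t s ≤
        -(1 / 2) * euclNorm (errW r t s) ^ 2 - q / 2 * euclNorm (bodyErr r k t s) ^ 2 := by
  obtain ⟨Λ, hΛ0, hΛ⟩ := exists_euclNorm_mulVec_le P.J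
  obtain ⟨j, hj0, hj⟩ := PosDef.exists_le_dot P.J_posDef
  have hB0 : 0 ≤ B := (euclNorm_nonneg _).trans (hB 0 le_rfl)
  have hM : 0 < 3 * Λ * k + (2 * Λ * B + 1) ^ 2 / 2 := by positivity
  set M := 3 * Λ * k + (2 * Λ * B + 1) ^ 2 / 2
  set q := min (1 / 2 / M) (min (j / 2 / Λ ^ 2) (1 / (2 * k))) with hqdef
  have hq : 0 < q := by positivity
  have hq1 : q * M ≤ 1 / 2 := by
    rw [← le_div_iff₀ hM]; exact min_le_left _ _
  have hq2 : q * Λ ^ 2 ≤ j / 2 := by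
    rw [← le_div_iff₀ (by positivity)]; exact (min_le_right _ _).trans (min_le_left _ _)
  have hq3 : q ≤ 1 / (2 * k) := (min_le_right _ _).trans (min_le_right _ _)
  refine ⟨q, min (j / 4) (1 / (4 * k)), max (Λ / 2 + j / 4) (2 / k), hq, by positivity,
    by positivity, fun t s ht hR hN => ⟨?_, ?_, ?_⟩⟩
  · refine le_trans ?_ (rotLyap_bounds hk ht hq hR hN hΛ hj hq2 hq3).1
    rw [mul_add]
    gcongr
    · exact min_le_left _ _
    · exact min_le_right _ _
  · refine (rotLyap_bounds hk ht hq hR hN hΛ hj hq2 hq3).2.trans ?_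
    rw [mul_add]
    gcongr
    · exact le_max_left _ _
    · exact le_max_right _ _
  · exact rotLyapRate_le hk ht hq hR hN (hB t ht) hΛ0.le hΛ hq1

end Rotation

/-! ### Exponential decay of the full error -/

theorem errNorm_eq {P : Body} {r : Reference} {k t : ℝ} {s : State} (ht : 0 ≤ t) :
    errNorm r (scalarGains P k) t s =
      √(errX r t s ⬝ᵥ errX r t s + errV r t s ⬝ᵥ errV r t s +
        (euclNorm (errW r t s) ^ 2 + euclNorm (bodyErr r k t s) ^ 2)) := by
  rw [errNorm, euclNorm_errR ht, euclNorm_sq (errX r t s), euclNorm_sq (errV r t s)]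
  congr 1
  ring

theorem exists_exponential_bound (P : Body) (r : Reference) {k ψ fMd fcM B : ℝ} (hψ : 0 < ψ)
    (hk : 192 * ψ ≤ k) (hk' : 576 * ψ * fMd ^ 2 ≤ k * fcM ^ 2) (hfcM : 0 < fcM)
    (hF : ∀ t, 0 ≤ t → euclNorm ((P.m * P.g) • e3 + P.m • r.ad t) ≤ fMd)
    (hB : ∀ t, 0 ≤ t → euclNorm (r.wd t) ≤ B) :
    ∃ C lam : ℝ, 0 < C ∧ 0 < lam ∧ ∀ (t₀ T : ℝ) (s : ℝ → State), 0 ≤ t₀ →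
      IsMotionOn P r (scalarGains P k) (Set.Icc t₀ T) s →
      attEnergy P r (scalarGains P k) t₀ (s t₀) < ψ →
      lyapX P r (scalarGains P k) t₀ (s t₀) (P.m / 4) ≤ fcM ^ 2 / (2 * P.m) →
      ∀ t ∈ Set.Icc t₀ T, errNorm r (scalarGains P k) t (s t) ≤
        C * Real.exp (-lam * (t - t₀)) * errNorm r (scalarGains P k) t₀ (s t₀) := by
  have hm := P.m_pos
  have hk0 : 0 < k := by linarith
  obtain ⟨q, a, b, hq, ha, hb, hrot⟩ := exists_rotLyap P r hk0 hB
  -- The disturbance `(2/m)‖d‖²` of `V_x` is at most `G ‖e_R‖²`, by `kΨ ≤ ‖e_R‖²` and the bound `fcM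
  -- + fMd` on the desired force.
  set G := 2 / P.m * (9 / k ^ 2 * (fcM + fMd) ^ 2) with hG
  have hG0 : 0 ≤ G := by positivity
  -- The weight is chosen so that the rotational decay `N q/2` of `‖e_R‖²` pays for `G` and leaves
  -- `1`.
  set N := (2 * G + 2) / q with hN
  have hN0 : 0 < N := by positivity
  have hNq : N * (q / 2) = G + 1 := by rw [hN]; field_simp
  -- The remaining decay coefficients of the translational error, `‖e_ω‖²` and `‖e_R‖²`; `m/64` is
  -- the rate `1/4` times the coercivity constant `m/16` of `V_x`.
  set κ := min (P.m / 64) (min (N / 2) 1) with hκ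
  have hκ0 : 0 < κ := by positivity
  set cu := P.m + N * b with hcu
  have hcu0 : 0 < cu := by positivity
  set cl := min (P.m / 16) (N * a) with hcl
  have hcl0 : 0 < cl := by positivity
  refine ⟨√(cu / cl), κ / cu / 2, by positivity, by positivity,
    fun t₀ T s ht₀ hs hE hV t ht => ?_⟩
  have hS : Set.Icc t₀ T ⊆ Set.Ici 0 := fun u hu => ht₀.trans hu.1
  have ht₀' : t₀ ∈ Set.Icc t₀ T := Set.left_mem_Icc.mpr (ht.1.trans ht.2)
  have hNav : ∀ u ∈ Set.Icc t₀ T, navFun r (scalarGains P k) u (s u) ≤ k := fun u hu =>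
    (navFun_le_attEnergy (P := P) _).trans ((hs.attEnergy_le ht₀ hu).trans (by linarith))
  set E : ℝ → ℝ := fun u => errX r u (s u) ⬝ᵥ errX r u (s u) + errV r u (s u) ⬝ᵥ errV r u (s u) +
        (euclNorm (errW r u (s u)) ^ 2 + euclNorm (bodyErr r k u (s u)) ^ 2) with hEdef
  set L : ℝ → ℝ := fun u => lyapX P r (scalarGains P k) u (s u) (P.m / 4) +
    N * rotLyap P r k q u (s u) with hL
  have hLE : ∀ u ∈ Set.Icc t₀ T, cl * E u ≤ L u ∧ L u ≤ cu * E u := fun u hu => by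
    obtain ⟨h1, h2, -⟩ := hrot u (s u) (hS hu) (hs.R_mem u hu) (hNav u hu)
    have h3 := le_lyapX (P := P) (r := r) (k := k) (t := u) (s₀ := s u)
    have h4 := lyapX_le (P := P) (r := r) (k := k) (t := u) (s₀ := s u)
    have hA : 0 ≤ errX r u (s u) ⬝ᵥ errX r u (s u) + errV r u (s u) ⬝ᵥ errV r u (s u) :=
      add_nonneg (dot_self_nonneg _) (dot_self_nonneg _)
    have hR : 0 ≤ euclNorm (errW r u (s u)) ^ 2 + euclNorm (bodyErr r k u (s u)) ^ 2 := by
      positivity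
    simp only [hEdef, hL]
    generalize errX r u (s u) ⬝ᵥ errX r u (s u) + errV r u (s u) ⬝ᵥ errV r u (s u) = A at *
    generalize euclNorm (errW r u (s u)) ^ 2 + euclNorm (bodyErr r k u (s u)) ^ 2 = R at *
    have h5 := mul_le_mul_of_nonneg_left h1 hN0.le
    have h6 := mul_le_mul_of_nonneg_left h2 hN0.le
    have h7 := mul_le_mul_of_nonneg_right (min_le_left (P.m / 16) (N * a)) hA
    have h8 := mul_le_mul_of_nonneg_right (min_le_right (P.m / 16) (N * a)) hR
    have h9 : 0 ≤ N * b * A := by positivity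
    have h10 := mul_nonneg hm.le hR
    constructor
    · rw [mul_add]; linarith
    · rw [hcu]; linarith
  have hdec := le_exp_mul_of_deriv_le (c := κ / cu) (f := L)
    (fun u hu => (hs.lyapX_deriv hS hu).add ((hs.rotLyap_deriv (q := q) hS hu).const_mul N))
    (fun u hu => ?_) t ht
  · have h1 := (hLE t ht).1.trans hdec
    have h2 : E t ≤ cu / cl * Real.exp (-(κ / cu) * (t - t₀)) * E t₀ := by
      have h3 := mul_le_mul_of_nonneg_left (hLE t₀ ht₀').2
        (Real.exp_pos (-(κ / cu) * (t - t₀))).le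
      rw [div_mul_eq_mul_div, div_mul_eq_mul_div, le_div_iff₀ hcl0]
      simp only [hL] at h1 h3
      linarith
    rw [errNorm_eq (hS ht), errNorm_eq ht₀]
    refine (Real.sqrt_le_sqrt h2).trans_eq ?_
    rw [Real.sqrt_mul (by positivity), Real.sqrt_mul (by positivity), ← Real.exp_half]
    congr 3
    ring
  · obtain ⟨-, -, h1⟩ := hrot u (s u) (hS hu) (hs.R_mem u hu) (hNav u hu)
    have hLu := (hLE u hu).2
    have h2 := lyapX_rate_le (P := P) (r := r) (k := k) (t := u) (s₀ := s u)
      (d := forceDefect P r (scalarGains P k) u (s u))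
    have h3 := le_lyapX (P := P) (r := r) (k := k) (t := u) (s₀ := s u)
    have hVu := hs.lyapX_le_level ht₀ hψ hk hk' hF hE hV hu
    have hf := desiredForce_le hfcM.le (hF u (hS hu)) hVu
    have hd := forceDefect_sq_le (P := P) hk0 (hS hu) (hs.R_mem u hu) (hNav u hu)
    have hp := mul_navFun_le (P := P) (r := r) hk0 (hS hu) (hs.R_mem u hu) (hNav u hu)
    have hp0 := navFun_nonneg (P := P) (r := r) hk0 (hS hu) (hs.R_mem u hu)
    rw [← euclNorm_sq (bodyErr r k u (s u))] at hp
    have hd' : 2 / P.m * (forceDefect P r (scalarGains P k) u (s u) ⬝ᵥ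
        forceDefect P r (scalarGains P k) u (s u)) ≤ G * euclNorm (bodyErr r k u (s u)) ^ 2 := by
      rw [hG, mul_assoc]
      gcongr
      refine hd.trans ?_
      rw [← euclNorm_sq (desiredForce P r (scalarGains P k) u (s u))]
      have e1 : euclNorm (desiredForce P r (scalarGains P k) u (s u)) ^ 2 ≤ (fcM + fMd) ^ 2 :=
        pow_le_pow_left₀ (euclNorm_nonneg _) hf 2
      calc _ = 9 / k ^ 2 * (k * navFun r (scalarGains P k) u (s u)) *
            euclNorm (desiredForce P r (scalarGains P k) u (s u)) ^ 2 := by field_simp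
        _ ≤ 9 / k ^ 2 * euclNorm (bodyErr r k u (s u)) ^ 2 * (fcM + fMd) ^ 2 := by gcongr
        _ = _ := by ring
    have hκE : κ / cu * L u ≤ κ * E u := by
      rw [div_mul_eq_mul_div, div_le_iff₀ hcu0]
      have := mul_le_mul_of_nonneg_left hLu hκ0.le
      linarith
    have h4 := mul_le_mul_of_nonneg_left h1 hN0.le
    have hA : 0 ≤ errX r u (s u) ⬝ᵥ errX r u (s u) + errV r u (s u) ⬝ᵥ errV r u (s u) :=
      add_nonneg (dot_self_nonneg _) (dot_self_nonneg _)
    rw [neg_mul]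
    simp only [hL, hEdef] at hκE ⊢
    generalize errX r u (s u) ⬝ᵥ errX r u (s u) + errV r u (s u) ⬝ᵥ errV r u (s u) = A at *
    have hY := sq_nonneg (euclNorm (bodyErr r k u (s u)))
    have hW := sq_nonneg (euclNorm (errW r u (s u)))
    generalize euclNorm (bodyErr r k u (s u)) ^ 2 = Y at *
    generalize euclNorm (errW r u (s u)) ^ 2 = W at *
    have k1 := mul_le_mul_of_nonneg_right (show κ ≤ P.m / 64 from min_le_left _ _) hA
    have k2 := mul_le_mul_of_nonneg_right
      (show κ ≤ N / 2 from (min_le_right _ _).trans (min_le_left _ _)) hW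
    have k3 := mul_le_mul_of_nonneg_right
      (show κ ≤ 1 from (min_le_right _ _).trans (min_le_right _ _)) hY
    have k4 : N * (-(1 / 2) * W - q / 2 * Y) = -(N / 2 * W) - (G + 1) * Y := by
      rw [← hNq]; ring
    rw [k4] at h4
    linarith

/-! ### Global solutions of ordinary differential equations with an a priori bound -/

section ODE

variable {ι : Type*} [Fintype ι]

/-- Coordinatewise truncation to `[-M, M]`. -/
def clamp (M : ℝ) (x : ι → ℝ) : ι → ℝ := fun i => max (-M) (min M (x i))

theorem clamp_eq_self {M : ℝ} {x : ι → ℝ} (hx : ‖x‖ ≤ M) : clamp M x = x := by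
  have hM : 0 ≤ M := (norm_nonneg _).trans hx
  ext i
  have h := abs_le.mp ((pi_norm_le_iff_of_nonneg hM).mp hx i)
  rw [clamp, min_eq_right h.2, max_eq_right h.1]

theorem norm_clamp_le {M : ℝ} (hM : 0 ≤ M) (x : ι → ℝ) : ‖clamp M x‖ ≤ M := by
  refine (pi_norm_le_iff_of_nonneg hM).mpr fun i => ?_
  rw [Real.norm_eq_abs, abs_le]
  exact ⟨le_max_left _ _, max_le (by linarith) (min_le_left _ _)⟩

theorem dist_clamp_le (M : ℝ) (x y : ι → ℝ) : dist (clamp M x) (clamp M y) ≤ dist x y := by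
  refine (dist_pi_le_iff dist_nonneg).mpr fun i => ?_
  refine le_trans ?_ (dist_le_pi_dist x y i)
  simp only [clamp, Real.dist_eq]
  rw [max_comm (-M), max_comm (-M), min_comm M, min_comm M]
  exact (abs_max_sub_max_le_abs (min (x i) M) (min (y i) M) (-M)).trans
    (abs_inf_sub_inf_le_abs (x i) (y i) M)

/-- A solution on a compact interval exists if solutions obey an a priori bound. -/
theorem exists_solution_Icc {F : ℝ → (ι → ℝ) → ι → ℝ} {t₀ T M : ℝ} {x₀ : ι → ℝ} (hT : t₀ ≤ T)
    (hlip : ∀ M, ∃ K, ∀ t ∈ Set.Icc t₀ T, LipschitzOnWith K (F t) (Metric.closedBall 0 M))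
    (hcont : ∀ x, ContinuousOn (F · x) (Set.Icc t₀ T))
    (hM : ∀ T' ≤ T, ∀ γ : ℝ → ι → ℝ, γ t₀ = x₀ →
      (∀ t ∈ Set.Icc t₀ T', HasDerivWithinAt γ (F t (γ t)) (Set.Icc t₀ T') t) →
      ∀ t ∈ Set.Icc t₀ T', ‖γ t‖ ≤ M) :
    ∃ γ : ℝ → ι → ℝ, γ t₀ = x₀ ∧
      ∀ t ∈ Set.Icc t₀ T, HasDerivWithinAt γ (F t (γ t)) (Set.Icc t₀ T) t := by
  -- Truncating the state at `M' > M` makes the field globally Lipschitz and bounded, so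
  -- Picard–Lindelöf covers the whole interval. Up to a first time with norm `M'` the truncation is
  -- inactive and the a priori bound `M` holds, so by continuity there is no such time.
  set M' := max M ‖x₀‖ + 1 with hM'
  have hM'0 : 0 ≤ M' := by positivity
  have hMM' : M < M' := by rw [hM']; linarith [le_max_left M ‖x₀‖]
  have hxM' : ‖x₀‖ < M' := by rw [hM']; linarith [le_max_right M ‖x₀‖]
  obtain ⟨K, hK⟩ := hlip M'
  have hmem : ∀ x : ι → ℝ, clamp M' x ∈ Metric.closedBall (0 : ι → ℝ) M' := fun x => by
    rw [mem_closedBall_zero_iff]; exact norm_clamp_le hM'0 x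
  obtain ⟨L₀, hL₀⟩ := isCompact_Icc.exists_bound_of_continuousOn (hcont 0)
  have hbound : ∀ t ∈ Set.Icc t₀ T, ∀ x, ‖F t (clamp M' x)‖ ≤ K * M' + max L₀ 0 := by
    intro t ht x
    have h1 := (hK t ht).dist_le_mul _ (hmem x) 0 (by simpa using hM'0)
    rw [dist_eq_norm, dist_zero_right] at h1
    have h2 := norm_le_norm_add_norm_sub (F t 0) (F t (clamp M' x))
    rw [norm_sub_rev] at h2
    have h3 : (K : ℝ) * ‖clamp M' x‖ ≤ K * M' := by gcongr; exact norm_clamp_le hM'0 x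
    linarith [hL₀ t ht, le_max_left L₀ 0]
  set L : NNReal := ⟨K * M' + max L₀ 0, by positivity⟩ with hL
  have hPL : IsPicardLindelof (fun t x => F t (clamp M' x)) (⟨t₀, Set.left_mem_Icc.mpr hT⟩ :
      Set.Icc t₀ T) x₀ (L * ⟨T - t₀, sub_nonneg.mpr hT⟩) 0 L K := by
    refine ⟨fun t ht => ?_, fun x _ => hcont _, fun t ht x _ => hbound t ht x, ?_⟩
    · refine LipschitzOnWith.of_dist_le_mul fun x _ y _ => ?_
      refine ((hK t ht).dist_le_mul _ (hmem x) _ (hmem y)).trans ?_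
      gcongr
      exact dist_clamp_le _ _ _
    · simp only [sub_self, NNReal.coe_zero, sub_zero]
      rw [max_eq_left (sub_nonneg.mpr hT)]
      rfl
  obtain ⟨γ, hγ0, hγ⟩ := hPL.exists_eq_forall_mem_Icc_hasDerivWithinAt₀
  simp only at hγ0
  have hγc : ContinuousOn γ (Set.Icc t₀ T) := fun t ht => (hγ t ht).continuousWithinAt
  have hstay : ∀ t ∈ Set.Icc t₀ T, ‖γ t‖ ≤ M' := by
    by_contra! hne
    obtain ⟨t₁, ht₁, hbig⟩ := hne
    set A := Set.Icc t₀ T ∩ (fun t => ‖γ t‖) ⁻¹' Set.Ici M' with hA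
    have hAc : IsCompact A :=
      isCompact_Icc.of_isClosed_subset
        (hγc.norm.preimage_isClosed_of_isClosed isClosed_Icc isClosed_Ici) Set.inter_subset_left
    obtain ⟨τ, hτA, hτ⟩ := hAc.exists_isLeast ⟨t₁, ht₁, hbig.le⟩
    have hτ0 : t₀ < τ := by
      refine lt_of_le_of_ne hτA.1.1 fun h => ?_
      have h2 : M' ≤ ‖γ τ‖ := hτA.2
      rw [← h, hγ0] at h2
      linarith
    have hlt : ∀ t ∈ Set.Ico t₀ τ, ‖γ t‖ < M' := fun t ht => by
      by_contra! h
      exact absurd (hτ ⟨⟨ht.1, ht.2.le.trans hτA.1.2⟩, h⟩) (not_le.mpr ht.2)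
    have hle : ∀ t ∈ Set.Ico t₀ τ, ‖γ t‖ ≤ M := fun t ht => by
      have hsub : Set.Icc t₀ t ⊆ Set.Icc t₀ T :=
        Set.Icc_subset_Icc le_rfl (ht.2.le.trans hτA.1.2)
      refine hM t (ht.2.le.trans hτA.1.2) γ hγ0 (fun u hu => ?_) t (Set.right_mem_Icc.mpr ht.1)
      have := (hγ u (hsub hu)).mono hsub
      rwa [clamp_eq_self (hlt u ⟨hu.1, hu.2.trans_lt ht.2⟩).le] at this
    have hτM : ‖γ τ‖ ≤ M := by
      have hcl : τ ∈ closure (Set.Ico t₀ τ) := by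
        rw [closure_Ico hτ0.ne]; exact Set.right_mem_Icc.mpr hτ0.le
      have hc : ContinuousWithinAt (fun t => ‖γ t‖) (Set.Ico t₀ τ) τ :=
        ((hγc τ hτA.1).mono fun u hu => ⟨hu.1, hu.2.le.trans hτA.1.2⟩).norm
      exact hc.closure_le hcl continuousWithinAt_const hle
    have h2 : M' ≤ ‖γ τ‖ := hτA.2
    linarith
  refine ⟨γ, hγ0, fun t ht => ?_⟩
  have := hγ t ht
  rwa [clamp_eq_self (hstay t ht)] at this

/-- Both solutions stay in a common ball by compactness, where the field is Lipschitz. This makes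
the solutions on growing intervals agree, so that they can be glued. -/
theorem eqOn_of_solutions {F : ℝ → (ι → ℝ) → ι → ℝ} {t₀ T : ℝ}
    (hlip : ∀ M, ∃ K, ∀ t ∈ Set.Icc t₀ T, LipschitzOnWith K (F t) (Metric.closedBall 0 M))
    {γ γ' : ℝ → ι → ℝ} (h0 : γ t₀ = γ' t₀)
    (hγ : ∀ t ∈ Set.Icc t₀ T, HasDerivWithinAt γ (F t (γ t)) (Set.Icc t₀ T) t)
    (hγ' : ∀ t ∈ Set.Icc t₀ T, HasDerivWithinAt γ' (F t (γ' t)) (Set.Icc t₀ T) t) :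
    Set.EqOn γ γ' (Set.Icc t₀ T) := by
  have hc : ContinuousOn γ (Set.Icc t₀ T) := fun t ht => (hγ t ht).continuousWithinAt
  have hc' : ContinuousOn γ' (Set.Icc t₀ T) := fun t ht => (hγ' t ht).continuousWithinAt
  obtain ⟨M, hM⟩ := isCompact_Icc.exists_bound_of_continuousOn hc
  obtain ⟨M', hM'⟩ := isCompact_Icc.exists_bound_of_continuousOn hc'
  obtain ⟨K, hK⟩ := hlip (max M M')
  have hright : ∀ {g : ℝ → ι → ℝ},
      (∀ t ∈ Set.Icc t₀ T, HasDerivWithinAt g (F t (g t)) (Set.Icc t₀ T) t) →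
      ∀ t ∈ Set.Ico t₀ T, HasDerivWithinAt g (F t (g t)) (Set.Ici t) t := fun hg t ht =>
    (hg t ⟨ht.1, ht.2.le⟩).mono_of_mem_nhdsWithin
      (Filter.mem_of_superset (Icc_mem_nhdsGE ht.2) (Set.Icc_subset_Icc ht.1 le_rfl))
  exact ODE_solution_unique_of_mem_Icc_right (s := fun _ => Metric.closedBall 0 (max M M'))
    (fun t ht => hK t ⟨ht.1, ht.2.le⟩) hc (hright hγ)
    (fun t ht => mem_closedBall_zero_iff.mpr ((hM t ⟨ht.1, ht.2.le⟩).trans (le_max_left _ _)))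
    hc' (hright hγ')
    (fun t ht => mem_closedBall_zero_iff.mpr ((hM' t ⟨ht.1, ht.2.le⟩).trans (le_max_right _ _))) h0

/-- A locally Lipschitz equation whose solutions are bounded on bounded time intervals has a
global solution. -/
theorem exists_solution_Ici {F : ℝ → (ι → ℝ) → ι → ℝ} {t₀ : ℝ} {x₀ : ι → ℝ}
    (hlip : ∀ T M, ∃ K, ∀ t ∈ Set.Icc t₀ T, LipschitzOnWith K (F t) (Metric.closedBall 0 M))
    (hcont : ∀ x, ContinuousOn (F · x) (Set.Ici t₀))
    (hbdd : ∀ T, ∃ M, ∀ T' ≤ T, ∀ γ : ℝ → ι → ℝ, γ t₀ = x₀ →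
      (∀ t ∈ Set.Icc t₀ T', HasDerivWithinAt γ (F t (γ t)) (Set.Icc t₀ T') t) →
      ∀ t ∈ Set.Icc t₀ T', ‖γ t‖ ≤ M) :
    ∃ γ : ℝ → ι → ℝ, γ t₀ = x₀ ∧
      ∀ t ∈ Set.Ici t₀, HasDerivWithinAt γ (F t (γ t)) (Set.Ici t₀) t := by
  have hex : ∀ n : ℕ, ∃ γ : ℝ → ι → ℝ, γ t₀ = x₀ ∧ ∀ t ∈ Set.Icc t₀ (t₀ + n),
      HasDerivWithinAt γ (F t (γ t)) (Set.Icc t₀ (t₀ + n)) t := fun n => by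
    obtain ⟨M, hM⟩ := hbdd (t₀ + n)
    exact exists_solution_Icc (by linarith [n.cast_nonneg (α := ℝ)]) (hlip _)
      (fun x => (hcont x).mono Set.Icc_subset_Ici_self) hM
  choose γ hγ0 hγ using hex
  have hmono : ∀ n m : ℕ, n ≤ m → Set.EqOn (γ n) (γ m) (Set.Icc t₀ (t₀ + n)) := fun n m hnm => by
    have hsub : Set.Icc t₀ (t₀ + n) ⊆ Set.Icc t₀ (t₀ + m) :=
      Set.Icc_subset_Icc le_rfl (by gcongr)
    exact eqOn_of_solutions (hlip _) ((hγ0 n).trans (hγ0 m).symm) (hγ n)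
      fun t ht => (hγ m t (hsub ht)).mono hsub
  set g : ℝ → ι → ℝ := fun t => γ ⌈t - t₀⌉₊ t with hg
  have hgN : ∀ N : ℕ, Set.EqOn g (γ N) (Set.Icc t₀ (t₀ + N)) := fun N t ht => by
    refine hmono _ _ (Nat.ceil_le.mpr (by linarith [ht.2])) ⟨ht.1, ?_⟩
    linarith [Nat.le_ceil (t - t₀)]
  refine ⟨g, ?_, fun t ht => ?_⟩
  · rw [hgN 0 (by simp), hγ0]
  · set N := ⌈t - t₀⌉₊ + 1 with hN
    have htN : t < t₀ + N := by
      rw [hN]; push_cast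
      linarith [Nat.le_ceil (t - t₀)]
    have htmem : t ∈ Set.Icc t₀ (t₀ + N) := ⟨ht, htN.le⟩
    have h1 : HasDerivWithinAt g (F t (g t)) (Set.Icc t₀ (t₀ + N)) t := by
      rw [hgN N htmem]
      exact (hγ N t htmem).congr (hgN N) (hgN N htmem)
    refine h1.mono_of_mem_nhdsWithin ?_
    rw [← Set.Ici_inter_Iic]
    exact Filter.inter_mem self_mem_nhdsWithin (mem_nhdsWithin_of_mem_nhds (Iic_mem_nhds htN))

/-- The Lipschitz hypothesis for a `C¹` field depending on time through a continuous parameter. -/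
theorem exists_lipschitzOnWith_of_contDiff {Q : Type*} [NormedAddCommGroup Q] [NormedSpace ℝ Q]
    {G : Q × (ι → ℝ) → ι → ℝ} (hG : ContDiff ℝ 1 G) {φ : ℝ → Q} {S : Set ℝ} (hS : IsCompact S)
    (hφ : ContinuousOn φ S) (M : ℝ) :
    ∃ K, ∀ t ∈ S, LipschitzOnWith K (fun x => G (φ t, x)) (Metric.closedBall 0 M) := by
  have hc : IsCompact ((φ '' S) ×ˢ Metric.closedBall (0 : ι → ℝ) M) :=
    (hS.image_of_continuousOn hφ).prod (isCompact_closedBall _ _)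
  obtain ⟨K, hK⟩ := hG.locallyLipschitz.locallyLipschitzOn.exists_lipschitzOnWith_of_compact hc
  refine ⟨K, fun t ht => LipschitzOnWith.of_dist_le_mul fun x hx y hy => ?_⟩
  refine (hK.dist_le_mul (φ t, x) ⟨⟨t, ht, rfl⟩, hx⟩ (φ t, y) ⟨⟨t, ht, rfl⟩, hy⟩).trans_eq ?_
  rw [Prod.dist_eq, dist_self, max_eq_right dist_nonneg]

end ODE

/-! ### Invariance of the rotation group -/

/-- The defect `Y = RᵀR - 1` obeys `Y' = [Y, ŵ]`, so `tr Y²` is constant, hence zero; as `Y` is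
symmetric, this is its squared Frobenius norm. The determinant is then `±1` and continuous, so it
keeps the value `1`. No regularity of `w` is needed. -/
theorem mem_specialOrthogonalGroup_of_deriv {R : ℝ → Mat3} {w : ℝ → Vec3} {t₀ T : ℝ}
    (hR : ∀ t ∈ Set.Icc t₀ T, HasDerivWithinAt R (R t * hat (w t)) (Set.Icc t₀ T) t)
    (h0 : R t₀ ∈ specialOrthogonalGroup (Fin 3) ℝ) :
    ∀ t ∈ Set.Icc t₀ T, R t ∈ specialOrthogonalGroup (Fin 3) ℝ := by
  have hskew : ∀ u, (hat u)ᵀ = -hat u := fun u => by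
    ext i j; fin_cases i <;> fin_cases j <;> simp [hat]
  have horth : ∀ t ∈ Set.Icc t₀ T, (R t)ᵀ * R t = 1 := fun t ht => by
    have hY : ∀ t ∈ Set.Icc t₀ T, HasDerivWithinAt (fun u => (R u)ᵀ * R u - 1)
        (((R t)ᵀ * R t - 1) * hat (w t) - hat (w t) * ((R t)ᵀ * R t - 1)) (Set.Icc t₀ T) t := by
      intro t ht
      have h1 := hasDerivWithinAt_matMul (hasDerivWithinAt_transpose (hR t ht)) (hR t ht)
      rw [hasDerivWithinAt_mat] at h1 ⊢
      intro i j
      refine ((h1 i j).sub_const ((1 : Mat3) i j)).congr_deriv ?_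
      refine congrFun (congrFun (?_ : _ = (_ : Mat3)) i) j
      rw [transpose_mul, hskew]
      noncomm_ring
    have hφ : ∀ t ∈ Set.Icc t₀ T,
        HasDerivWithinAt (fun u => (((R u)ᵀ * R u - 1) * ((R u)ᵀ * R u - 1)).trace) 0
          (Set.Icc t₀ T) t := fun t ht => by
      refine (hasDerivWithinAt_trace
        (hasDerivWithinAt_matMul (hY t ht) (hY t ht))).congr_deriv ?_
      generalize (R t)ᵀ * R t - 1 = Y
      generalize hat (w t) = W
      have e1 := Matrix.trace_mul_comm (Y * Y) W
      have e2 := Matrix.trace_mul_comm (Y * W) Y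
      simp only [Matrix.sub_mul, Matrix.mul_sub, trace_add, trace_sub, ← Matrix.mul_assoc]
      simp only [← Matrix.mul_assoc] at e1 e2
      linarith
    have h1 := le_exp_mul_of_deriv_le (c := 0) hφ (fun u _ => by simp) t ht
    rw [transpose_mul_self_of_mem h0] at h1
    simp only [sub_self, mul_zero, Matrix.trace_zero] at h1
    have hsymm : ((R t)ᵀ * R t - 1)ᵀ = (R t)ᵀ * R t - 1 := by
      simp [transpose_sub, transpose_mul]
    generalize hYd : (R t)ᵀ * R t - 1 = Y at h1 hsymm
    have h2 : (Yᵀ * Y).trace = 0 := by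
      refine le_antisymm (by rwa [hsymm]) ?_
      simp only [trace_eq, Matrix.mul_apply, transpose_apply]
      have : ∀ i, 0 ≤ ∑ j, Y j i * Y j i := fun i => Finset.sum_nonneg fun j _ => mul_self_nonneg _
      linarith [this 0, this 1, this 2]
    have h3 : Y = 0 := by
      have := trace_conjTranspose_mul_self_eq_zero_iff (A := Y)
      rw [conjTranspose_eq_transpose_of_trivial] at this
      exact this.mp h2
    rw [h3] at hYd
    exact sub_eq_zero.mp hYd
  intro t ht
  have hdet : ∀ u ∈ Set.Icc t₀ T, (R u).det ^ 2 = 1 := fun u hu => by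
    have := congrArg Matrix.det (horth u hu)
    rwa [det_mul, det_transpose, det_one, ← sq] at this
  have hcont : ContinuousOn (fun u => (R u).det) (Set.Icc t₀ t) := by
    have hent : ∀ i j, ContinuousOn (fun u => R u i j) (Set.Icc t₀ t) := fun i j u hu =>
      ((hasDerivWithinAt_mat.mp (hR u ⟨hu.1, hu.2.trans ht.2⟩) i j).continuousWithinAt).mono
        (Set.Icc_subset_Icc le_rfl ht.2)
    simp only [det_fin_three]
    fun_prop
  refine mem_specialOrthogonalGroup_iff.mpr ⟨(mem_orthogonalGroup_iff' ..).mpr (horth t ht), ?_⟩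
  rcases mul_self_eq_one_iff.mp ((sq _).symm.trans (hdet t ht)) with h | h
  · exact h
  · have h1 := (mem_specialOrthogonalGroup_iff.mp h0).2
    obtain ⟨u, hu, hu0⟩ := intermediate_value_Icc' ht.1 hcont
      (show (0 : ℝ) ∈ Set.Icc (R t).det (R t₀).det by rw [h, h1]; norm_num)
    have := hdet u ⟨hu.1, hu.2.trans ht.2⟩
    simp only at hu0
    rw [hu0] at this
    norm_num at this

/-! ### The closed loop as a smooth differential equation -/

/-- Coordinates of the state: position, velocity, angular velocity, attitude. -/
abbrev StateIdx := Fin 3 ⊕ Fin 3 ⊕ Fin 3 ⊕ Fin 3 × Fin 3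

/-- The state with given coordinates. -/
def toState (x : StateIdx → ℝ) : State where
  x i := x (.inl i)
  v i := x (.inr (.inl i))
  w i := x (.inr (.inr (.inl i)))
  R := of fun i j => x (.inr (.inr (.inr (i, j))))

/-- Assembling coordinates. -/
def assemble (x v w : Vec3) (R : Mat3) : StateIdx → ℝ :=
  Sum.elim x (Sum.elim v (Sum.elim w fun p => R p.1 p.2))

theorem toState_assemble (s : State) : toState (assemble s.x s.v s.w s.R) = s := rfl

/-- The reference data at one instant: `x_d`, `v_d`, `v_d'`, `R_d`, `ω_d`, `ω_d'`. -/
abbrev RefData := Vec3 × Vec3 × Vec3 × (Fin 3 → Fin 3 → ℝ) × Vec3 × Vec3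

/-- The data of a reference at time `t`. -/
def Reference.data (r : Reference) (t : ℝ) : RefData :=
  (r.xd t, r.vd t, r.ad t, r.Rd t, r.wd t, r.dwd t)

/-- The attitude error in terms of reference data. -/
def dataAttErr (p : RefData) (s : State) : Mat3 := s.R * (of p.2.2.2.1)ᵀ

/-- The control force in terms of reference data. -/
def dataForce (P : Body) (K : Gains) (p : RefData) (s : State) : Vec3 :=
  ((K.PsiM - 1 / 2 * (K.KR * (1 - dataAttErr p s)).trace) / K.PsiM) •
    ((of p.2.2.2.1)ᵀ *ᵥ
      (-(K.Kx *ᵥ (s.x - p.1)) - K.Kv *ᵥ (s.v - p.2.1) + P.m • (p.2.2.1 + P.g • e3)))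

/-- The control torque in terms of reference data. -/
def dataTorque (P : Body) (K : Gains) (p : RefData) (s : State) : Vec3 :=
  -((of p.2.2.2.1)ᵀ *ᵥ vee (skewPart (K.KR * dataAttErr p s))) - K.Kw *ᵥ (s.w - p.2.2.2.2.1) +
    P.J *ᵥ p.2.2.2.2.2 + p.2.2.2.2.1 ⨯₃ (P.J *ᵥ s.w)

/-- The closed-loop vector field in coordinates. -/
def closedLoopField (P : Body) (K : Gains) (q : RefData × (StateIdx → ℝ)) : StateIdx → ℝ :=
  assemble (toState q.2).v
    (P.m⁻¹ • (-((P.m * P.g) • e3) + (toState q.2).R *ᵥ dataForce P K q.1 (toState q.2)))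
    (P.J⁻¹ *ᵥ (-((toState q.2).w ⨯₃ (P.J *ᵥ (toState q.2).w)) +
      dataTorque P K q.1 (toState q.2)))
    ((toState q.2).R * hat (toState q.2).w)

/-! ### Smoothness of the closed-loop field. -/

section Smooth

variable {X : Type*} [NormedAddCommGroup X] [NormedSpace ℝ X]

theorem contDiff_dot {u v : X → Vec3} (hu : ContDiff ℝ 1 u) (hv : ContDiff ℝ 1 v) :
    ContDiff ℝ 1 fun q => u q ⬝ᵥ v q := by
  rw [contDiff_pi] at hu hv
  exact ContDiff.sum fun i _ => (hu i).mul (hv i)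

theorem contDiff_mulVec {A : X → Mat3} {v : X → Vec3} (hA : ∀ i j, ContDiff ℝ 1 fun q => A q i j)
    (hv : ContDiff ℝ 1 v) : ContDiff ℝ 1 fun q => A q *ᵥ v q :=
  contDiff_pi.mpr fun i => contDiff_dot (contDiff_pi.mpr (hA i)) hv

theorem contDiff_matMul {A B : X → Mat3} (hA : ∀ i j, ContDiff ℝ 1 fun q => A q i j)
    (hB : ∀ i j, ContDiff ℝ 1 fun q => B q i j) (i j : Fin 3) :
    ContDiff ℝ 1 fun q => (A q * B q) i j :=
  contDiff_dot (contDiff_pi.mpr (hA i)) (contDiff_pi.mpr fun l => hB l j)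

theorem contDiff_cross {u v : X → Vec3} (hu : ContDiff ℝ 1 u) (hv : ContDiff ℝ 1 v) :
    ContDiff ℝ 1 fun q => u q ⨯₃ v q := by
  rw [contDiff_pi] at hu hv
  rw [contDiff_pi]
  intro i
  fin_cases i <;> simp only [cross_apply] <;>
    exact ((hu _).mul (hv _)).sub ((hu _).mul (hv _))

theorem contDiff_trace {A : X → Mat3} (hA : ∀ i j, ContDiff ℝ 1 fun q => A q i j) :
    ContDiff ℝ 1 fun q => (A q).trace :=
  ContDiff.sum fun i _ => hA i i

theorem contDiff_vee_skewPart {A : X → Mat3} (hA : ∀ i j, ContDiff ℝ 1 fun q => A q i j) :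
    ContDiff ℝ 1 fun q => vee (skewPart (A q)) := by
  rw [contDiff_pi]
  intro i
  fin_cases i
  · exact contDiff_const.mul ((hA 2 1).sub (hA 1 2))
  · exact contDiff_const.mul ((hA 0 2).sub (hA 2 0))
  · exact contDiff_const.mul ((hA 1 0).sub (hA 0 1))

theorem contDiff_hat {u : X → Vec3} (hu : ContDiff ℝ 1 u) (i j : Fin 3) :
    ContDiff ℝ 1 fun q => hat (u q) i j := by
  rw [contDiff_pi] at hu
  fin_cases i <;> fin_cases j <;> simp [hat] <;>
    first | exact contDiff_const | exact hu _ | exact (hu _).neg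

end Smooth

/-- The field is polynomial in the reference data and the state. Time enters only through the data,
kept as a separate argument because accelerations of the reference are merely continuous. -/
theorem contDiff_closedLoopField (P : Body) (K : Gains) : ContDiff ℝ 1 (closedLoopField P K) := by
  have hc : ∀ (A : Mat3) (i j : Fin 3),
      ContDiff ℝ 1 fun _ : RefData × (StateIdx → ℝ) => A i j := fun _ _ _ => contDiff_const
  have hx : ContDiff ℝ 1 fun q : RefData × (StateIdx → ℝ) => (toState q.2).x := by
    rw [contDiff_pi]; intro i; simp only [toState]; fun_prop
  have hv : ContDiff ℝ 1 fun q : RefData × (StateIdx → ℝ) => (toState q.2).v := by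
    rw [contDiff_pi]; intro i; simp only [toState]; fun_prop
  have hw : ContDiff ℝ 1 fun q : RefData × (StateIdx → ℝ) => (toState q.2).w := by
    rw [contDiff_pi]; intro i; simp only [toState]; fun_prop
  have hR : ∀ i j, ContDiff ℝ 1 fun q : RefData × (StateIdx → ℝ) => (toState q.2).R i j := by
    intro i j; simp only [toState, of_apply]; fun_prop
  have hRd : ∀ i j, ContDiff ℝ 1 fun q : RefData × (StateIdx → ℝ) => (of q.1.2.2.2.1)ᵀ i j := by
    intro i j; simp only [transpose_apply, of_apply]; fun_prop
  have hA : ∀ i j, ContDiff ℝ 1 fun q : RefData × (StateIdx → ℝ) =>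
      dataAttErr q.1 (toState q.2) i j := contDiff_matMul hR hRd
  have hF : ContDiff ℝ 1 fun q : RefData × (StateIdx → ℝ) => dataForce P K q.1 (toState q.2) := by
    have h1 : ContDiff ℝ 1 fun q : RefData × (StateIdx → ℝ) =>
        (K.KR * (1 - dataAttErr q.1 (toState q.2))).trace :=
      contDiff_trace (contDiff_matMul (hc _) fun i j => contDiff_const.sub (hA i j))
    refine ContDiff.smul ((contDiff_const.sub (contDiff_const.mul h1)).div_const _)
      (contDiff_mulVec hRd (((contDiff_mulVec (hc _) (hx.sub (by fun_prop))).neg.sub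
        (contDiff_mulVec (hc _) (hv.sub (by fun_prop)))).add ?_))
    fun_prop
  have hτ : ContDiff ℝ 1 fun q : RefData × (StateIdx → ℝ) =>
      dataTorque P K q.1 (toState q.2) :=
    (((contDiff_mulVec hRd (contDiff_vee_skewPart (contDiff_matMul (hc _) hA))).neg.sub
      (contDiff_mulVec (hc _) (hw.sub (by fun_prop)))).add
      (contDiff_mulVec (hc _) (by fun_prop))).add
      (contDiff_cross (by fun_prop) (contDiff_mulVec (hc _) hw))
  rw [contDiff_pi]
  rintro (i | i | i | ⟨i, j⟩)
  · exact contDiff_pi.mp hv i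
  · exact contDiff_pi.mp ((contDiff_const.add (contDiff_mulVec hR hF)).const_smul P.m⁻¹) i
  · exact contDiff_pi.mp (contDiff_mulVec (hc _)
      ((contDiff_cross hw (contDiff_mulVec (hc _) hw)).neg.add hτ)) i
  · exact contDiff_matMul hR (contDiff_hat hw) i j

theorem Reference.continuousOn_data (r : Reference) : ContinuousOn r.data (Set.Ici 0) := by
  have hR : ContinuousOn (fun t => (r.Rd t : Fin 3 → Fin 3 → ℝ)) (Set.Ici 0) :=
    continuousOn_pi.mpr fun i => continuousOn_pi.mpr fun j => fun t ht =>
      (hasDerivWithinAt_mat.mp (r.Rd_deriv t ht) i j).continuousWithinAt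
  exact ContinuousOn.prodMk (fun t ht => (r.xd_deriv t ht).continuousWithinAt)
    (ContinuousOn.prodMk (fun t ht => (r.vd_deriv t ht).continuousWithinAt)
    (r.ad_cont.prodMk (hR.prodMk
    (ContinuousOn.prodMk (fun t ht => (r.wd_deriv t ht).continuousWithinAt) r.dwd_cont))))

/-! ### From solutions in coordinates to motions. -/

section Solutions

variable {P : Body} {r : Reference} {K : Gains} {S : Set ℝ} {γ : ℝ → StateIdx → ℝ} {t : ℝ}

theorem deriv_of_solution
    (h : HasDerivWithinAt γ (closedLoopField P K (r.data t, γ t)) S t) :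
    HasDerivWithinAt (fun u => (toState (γ u)).x) (toState (γ t)).v S t ∧
    HasDerivWithinAt (fun u => (toState (γ u)).R)
      ((toState (γ t)).R * hat (toState (γ t)).w) S t ∧
    HasDerivWithinAt (fun u => P.m • (toState (γ u)).v)
      (-((P.m * P.g) • e3) + (toState (γ t)).R *ᵥ controlForce P r K t (toState (γ t))) S t ∧
    HasDerivWithinAt (fun u => P.J *ᵥ (toState (γ u)).w)
      (-((toState (γ t)).w ⨯₃ (P.J *ᵥ (toState (γ t)).w)) +
        controlTorque P r K t (toState (γ t))) S t := by
  rw [hasDerivWithinAt_pi] at h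
  refine ⟨hasDerivWithinAt_pi.mpr fun i => h (.inl i),
    hasDerivWithinAt_mat.mpr fun i j => h (.inr (.inr (.inr (i, j)))), ?_, ?_⟩
  · have h1 : HasDerivWithinAt (fun u => (toState (γ u)).v) (P.m⁻¹ • (-((P.m * P.g) • e3) +
        (toState (γ t)).R *ᵥ controlForce P r K t (toState (γ t)))) S t :=
      hasDerivWithinAt_pi.mpr fun i => h (.inr (.inl i))
    have h2 := h1.const_smul P.m
    rwa [smul_smul, mul_inv_cancel₀ P.m_pos.ne', one_smul] at h2
  · have h1 : HasDerivWithinAt (fun u => (toState (γ u)).w)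
        (P.J⁻¹ *ᵥ (-((toState (γ t)).w ⨯₃ (P.J *ᵥ (toState (γ t)).w)) +
          controlTorque P r K t (toState (γ t)))) S t :=
      hasDerivWithinAt_pi.mpr fun i => h (.inr (.inr (.inl i)))
    have h2 := hasDerivWithinAt_const_mulVec P.J h1
    rwa [mulVec_mulVec, mul_nonsing_inv _ ((isUnit_iff_isUnit_det _).mp P.J_posDef.isUnit),
      one_mulVec] at h2

theorem isMotionOn_of_solution {t₀ T : ℝ}
    (h : ∀ t ∈ Set.Icc t₀ T,
      HasDerivWithinAt γ (closedLoopField P K (r.data t, γ t)) (Set.Icc t₀ T) t)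
    (h0 : (toState (γ t₀)).R ∈ specialOrthogonalGroup (Fin 3) ℝ) :
    IsMotionOn P r K (Set.Icc t₀ T) fun u => toState (γ u) where
  R_mem := mem_specialOrthogonalGroup_of_deriv
    (fun t ht => (deriv_of_solution (h t ht)).2.1) h0
  x_deriv t ht := (deriv_of_solution (h t ht)).1
  R_deriv t ht := (deriv_of_solution (h t ht)).2.1
  v_deriv t ht := (deriv_of_solution (h t ht)).2.2.1
  w_deriv t ht := (deriv_of_solution (h t ht)).2.2.2

theorem isClosedLoop_of_solution {t₀ : ℝ}
    (h : ∀ t ∈ Set.Ici t₀,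
      HasDerivWithinAt γ (closedLoopField P K (r.data t, γ t)) (Set.Ici t₀) t)
    (h0 : (toState (γ t₀)).R ∈ specialOrthogonalGroup (Fin 3) ℝ) :
    IsClosedLoop P r K t₀ fun u => toState (γ u) where
  R_mem t ht := (isMotionOn_of_solution (T := t) (fun u hu =>
    (h u hu.1).mono Set.Icc_subset_Ici_self) h0).R_mem t (Set.right_mem_Icc.mpr ht)
  x_deriv t ht := (deriv_of_solution (h t ht)).1
  R_deriv t ht := (deriv_of_solution (h t ht)).2.1
  v_deriv t ht := (deriv_of_solution (h t ht)).2.2.1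
  w_deriv t ht := (deriv_of_solution (h t ht)).2.2.2

/-- A closed loop whose state stays bounded, on bounded time intervals, as long as it exists, has
a global motion. -/
theorem exists_isClosedLoop {t₀ : ℝ} {s₀ : State} (ht₀ : 0 ≤ t₀)
    (hR : s₀.R ∈ specialOrthogonalGroup (Fin 3) ℝ)
    (hbdd : ∀ T, ∃ M, ∀ T' ≤ T, ∀ s : ℝ → State, s t₀ = s₀ →
      IsMotionOn P r K (Set.Icc t₀ T') s → ∀ t ∈ Set.Icc t₀ T', ∀ i,
        |(s t).x i| ≤ M ∧ |(s t).v i| ≤ M ∧ |(s t).w i| ≤ M) :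
    ∃ s : ℝ → State, IsClosedLoop P r K t₀ s ∧ s t₀ = s₀ := by
  have hdata : ContinuousOn r.data (Set.Ici t₀) :=
    r.continuousOn_data.mono (Set.Ici_subset_Ici.mpr ht₀)
  have hsmooth := contDiff_closedLoopField P K
  obtain ⟨γ, hγ0, hγ⟩ := exists_solution_Ici
    (F := fun t x => closedLoopField P K (r.data t, x)) (t₀ := t₀)
    (x₀ := assemble s₀.x s₀.v s₀.w s₀.R)
    (fun T M => exists_lipschitzOnWith_of_contDiff hsmooth isCompact_Icc
      (hdata.mono Set.Icc_subset_Ici_self) M)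
    (fun x => hsmooth.continuous.comp_continuousOn (hdata.prodMk continuousOn_const))
    (fun T => by
      obtain ⟨M, hM⟩ := hbdd T
      -- The `1` bounds the attitude coordinates, which are entries of an orthogonal matrix.
      refine ⟨max M 1, fun T' hT' γ hγ0 hγ t ht => ?_⟩
      have h0 : toState (γ t₀) = s₀ := by rw [hγ0, toState_assemble]
      have hm := isMotionOn_of_solution hγ (by rwa [h0])
      have hb := hM T' hT' _ h0 hm t ht
      refine (pi_norm_le_iff_of_nonneg (by positivity)).mpr ?_
      rintro (i | i | i | ⟨i, j⟩)
      · exact (hb i).1.trans (le_max_left _ _)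
      · exact (hb i).2.1.trans (le_max_left _ _)
      · exact (hb i).2.2.trans (le_max_left _ _)
      · exact (entry_norm_bound_of_unitary (mem_specialOrthogonalGroup_iff.mp
          (hm.R_mem t ht)).1 i j).trans (le_max_right _ _))
  have h0 : toState (γ t₀) = s₀ := by rw [hγ0, toState_assemble]
  exact ⟨_, isClosedLoop_of_solution hγ (by rwa [h0]), h0⟩

end Solutions

/-! ### The parameters -/

section Parameters

variable {P : Body} {r : Reference} {k t ψ fMd fcM p₁ : ℝ} {s₀ : State}

theorem scalarGains_positive (hk : 0 < k) : (scalarGains P k).Positive := by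
  have hm := P.m_pos
  exact ⟨posDef_smul_one (by positivity), posDef_smul_one (by positivity), Matrix.PosDef.one,
    fun _ => hk⟩

theorem c1_scalarGains : (scalarGains P k).c1 = 2 * k := by
  simp only [Gains.c1, scalarGains, min_self]
  ring

theorem h1_scalarGains : (scalarGains P k).h1 = 2 * k / (2 * k) ^ 2 := by
  rw [Gains.h1, c1_scalarGains]
  simp only [Gains.c2, Gains.c3, scalarGains, max_self, sub_self]
  ring

theorem lamMin_matPx1_le : lamMin (matPx1 P (scalarGains P k) (P.m / 4)) ≤ P.m / 4 := by
  have hm := P.m_pos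
  have h13 : √13 ^ 2 = (13 : ℝ) := Real.sq_sqrt (by norm_num)
  have h3 : (3 : ℝ) ≤ √13 := Real.le_sqrt_of_sq_le (by norm_num)
  -- The smaller root of the characteristic polynomial, with trace `5m/4` and determinant `3m²/16`.
  refine (lamMin_le (μ := P.m * (5 - √13) / 8) ?_).trans (by nlinarith)
  have : lamMin (scalarGains P k).Kx = P.m / 4 := lamMin_smul_one _
  rw [matPx1, this, det_fin_two]
  simp [scalar_apply]
  linear_combination P.m ^ 2 / 64 * h13

theorem forceLevel_le :
    forceLevel P (scalarGains P k) (P.m / 4) fcM ≤ fcM ^ 2 / (2 * P.m) := by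
  have hm := P.m_pos
  have hx : (scalarGains P k).Kxᵀ * (scalarGains P k).Kx = (P.m / 4 * (P.m / 4)) • (1 : Mat3) := by
    simp [scalarGains, smul_smul]
  have hv : (scalarGains P k).Kvᵀ * (scalarGains P k).Kv = (P.m / 2 * (P.m / 2)) • (1 : Mat3) := by
    simp [scalarGains, smul_smul]
  rw [forceLevel, hx, hv, lamMax_smul_one, lamMax_smul_one, max_eq_right (by nlinarith)]
  calc _ ≤ P.m / 4 * fcM ^ 2 / (2 * (P.m / 2 * (P.m / 2))) := by
        gcongr
        exact lamMin_matPx1_le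
    _ = _ := by field_simp; ring

/-- Since `Ψ ≥ ‖e_R‖²/(2k)`, the form in `‖e_ω‖` and `‖e_R‖` is nonnegative once `k p₁² ≤ j`. Hence
a bound on `V` is a bound on `V_x`. -/
theorem lyapR_nonneg {j : ℝ} (hk : 0 < k) (ht : 0 ≤ t)
    (hR : s₀.R ∈ specialOrthogonalGroup (Fin 3) ℝ) (hj0 : 0 < j)
    (hj : ∀ u : Vec3, j * (u ⬝ᵥ u) ≤ u ⬝ᵥ P.J *ᵥ u) (hp0 : 0 ≤ p₁) (hp : p₁ ≤ √(j / k)) :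
    0 ≤ lyapR P r (scalarGains P k) t s₀ p₁ := by
  have h1 := bodyErr_sq_le (P := P) (r := r) (k := k) ht hR
  rw [← euclNorm_sq, ← euclNorm_errR (P := P) ht] at h1
  rw [lyapR, attEnergy]
  have h2 := hj (errW r t s₀)
  have h3 := (abs_le.mp (abs_dot_le (errW r t s₀) (errR r (scalarGains P k) t s₀))).1
  rw [← euclNorm_sq] at h2
  have hW := euclNorm_nonneg (errW r t s₀)
  have hY := euclNorm_nonneg (errR r (scalarGains P k) t s₀)
  generalize euclNorm (errW r t s₀) = W at *
  generalize euclNorm (errR r (scalarGains P k) t s₀) = Y at *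
  generalize navFun r (scalarGains P k) t s₀ = p at *
  have hp2 : k * p₁ ^ 2 ≤ j := by
    have := pow_le_pow_left₀ hp0 hp 2
    rw [Real.sq_sqrt (by positivity), le_div_iff₀ hk] at this
    linarith
  have h4 : p₁ * (W * Y) ≤ 1 / 2 * (j * W ^ 2) + p := by
    have e1 : Y ^ 2 / (2 * k) ≤ p := by rw [div_le_iff₀ (by positivity)]; linarith
    have e2 := mul_le_mul_of_nonneg_right hp2 (sq_nonneg W)
    have e3 : 0 ≤ (k * p₁ * W - Y) ^ 2 / (2 * k) := by positivity
    have e4 : (k * p₁ * W - Y) ^ 2 / (2 * k) =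
        1 / 2 * (k * p₁ ^ 2 * W ^ 2) - p₁ * (W * Y) + Y ^ 2 / (2 * k) := by
      field_simp; ring
    linarith
  have h5 := mul_le_mul_of_nonneg_left h3 hp0
  linarith

theorem abs_apply_le (u : Vec3) (i : Fin 3) : |u i| ≤ euclNorm u := by
  rw [euclNorm_eq_norm]
  exact PiLp.norm_apply_le (WithLp.toLp 2 u) i

/-- A priori bounds for the state on bounded time intervals. -/
theorem exists_state_bound (ht₀ : 0 ≤ t) (hψ : 0 < ψ) (hk : 192 * ψ ≤ k)
    (hk' : 576 * ψ * fMd ^ 2 ≤ k * fcM ^ 2)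
    (hF : ∀ t, 0 ≤ t → euclNorm ((P.m * P.g) • e3 + P.m • r.ad t) ≤ fMd)
    (hE : attEnergy P r (scalarGains P k) t s₀ < ψ)
    (hV : lyapX P r (scalarGains P k) t s₀ (P.m / 4) ≤ fcM ^ 2 / (2 * P.m)) (T : ℝ) :
    ∃ M, ∀ T' ≤ T, ∀ s : ℝ → State, s t = s₀ →
      IsMotionOn P r (scalarGains P k) (Set.Icc t T') s → ∀ u ∈ Set.Icc t T', ∀ i,
        |(s u).x i| ≤ M ∧ |(s u).v i| ≤ M ∧ |(s u).w i| ≤ M := by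
  have hm := P.m_pos
  have hk0 : 0 < k := by linarith
  obtain ⟨j, hj0, hj⟩ := PosDef.exists_le_dot P.J_posDef
  obtain ⟨D, hD⟩ := (isCompact_Icc (a := t) (b := T)).exists_bound_of_continuousOn
    (r.continuousOn_data.mono fun u hu => ht₀.trans hu.1)
  set L := 16 / P.m * (fcM ^ 2 / (2 * P.m)) with hL
  have hL0 : 0 ≤ L := by positivity
  refine ⟨√L + √(2 * ψ / j) + D, fun T' hT' s hs0 hs u hu i => ?_⟩
  subst hs0
  have hu0 : 0 ≤ u := ht₀.trans hu.1
  have hVu := le_lyapX.trans (hs.lyapX_le_level ht₀ hψ hk hk' hF hE hV hu)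
  have hEu := (hs.attEnergy_le ht₀ hu).trans_lt hE
  have hN := navFun_nonneg (P := P) (r := r) hk0 hu0 (hs.R_mem u hu)
  have hd := hD u ⟨hu.1, hu.2.trans hT'⟩
  have hXV : errX r u (s u) ⬝ᵥ errX r u (s u) + errV r u (s u) ⬝ᵥ errV r u (s u) ≤ L := by
    calc _ = 16 / P.m * (P.m / 16 * (errX r u (s u) ⬝ᵥ errX r u (s u) +
          errV r u (s u) ⬝ᵥ errV r u (s u))) := by field_simp
      _ ≤ L := by rw [hL]; gcongr
  have hx : euclNorm (errX r u (s u)) ≤ √L := Real.sqrt_le_sqrt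
    (by linarith [dot_self_nonneg (errV r u (s u))])
  have hv : euclNorm (errV r u (s u)) ≤ √L := Real.sqrt_le_sqrt
    (by linarith [dot_self_nonneg (errX r u (s u))])
  have hw : euclNorm (errW r u (s u)) ≤ √(2 * ψ / j) := by
    refine Real.sqrt_le_sqrt ?_
    rw [le_div_iff₀ hj0]
    have := hj (errW r u (s u))
    rw [attEnergy] at hEu
    linarith
  have hxd : |r.xd u i| ≤ D :=
    ((norm_le_pi_norm (r.xd u) i).trans (norm_fst_le (r.data u))).trans hd
  have hvd : |r.vd u i| ≤ D :=
    ((norm_le_pi_norm (r.vd u) i).trans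
      ((norm_fst_le (r.data u).2).trans (norm_snd_le (r.data u)))).trans hd
  have hwd : |r.wd u i| ≤ D :=
    ((norm_le_pi_norm (r.wd u) i).trans ((norm_fst_le (r.data u).2.2.2.2).trans
      ((norm_snd_le (r.data u).2.2.2).trans ((norm_snd_le (r.data u).2.2).trans
      ((norm_snd_le (r.data u).2).trans (norm_snd_le (r.data u))))))).trans hd
  have h1 := (abs_apply_le (errX r u (s u)) i).trans hx
  have h2 := (abs_apply_le (errV r u (s u)) i).trans hv
  have h3 := (abs_apply_le (errW r u (s u)) i).trans hw
  have e1 : (s u).x i = errX r u (s u) i + r.xd u i := by simp [errX]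
  have e2 : (s u).v i = errV r u (s u) i + r.vd u i := by simp [errV]
  have e3 : (s u).w i = errW r u (s u) i + r.wd u i := by simp [errW]
  have hs1 := Real.sqrt_nonneg L
  have hs2 := Real.sqrt_nonneg (2 * ψ / j)
  rw [e1, e2, e3]
  refine ⟨(abs_add_le _ _).trans ?_, (abs_add_le _ _).trans ?_, (abs_add_le _ _).trans ?_⟩ <;>
    linarith

end Parameters

end
end RigidBodyTracking

/-! ### The proposition. -/

open RigidBodyTracking in
theorem proposition3 (P : Body) (r : Reference) (θM fM fMd : ℝ)
    (hθ : 0 < Real.cos θM)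
    (hr : r.ForceFeasible P fMd fM)
    (hw : ∃ B : ℝ, ∀ t, 0 ≤ t → euclNorm (r.wd t) ≤ B)
    (ψ : ℝ) (hψ : 0 < ψ)
    (fcM : ℝ) (hfcM : 0 < fcM) (hfcM' : fcM ≤ fM - fMd) :
    ∃ (K : Gains) (p₁ p₂ : ℝ),
      K.Positive ∧ ψ < K.c1 ∧ ψ < K.PsiM ∧
      0 < p₁ ∧ p₁ < √(K.h1 * lamMin P.J) ∧
      0 < p₂ ∧ p₂ < √(P.m * lamMin K.Kx) ∧
      ∃ C lam : ℝ, 0 < C ∧ 0 < lam ∧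
        ∀ (t₀ : ℝ) (s₀ : State), 0 ≤ t₀ →
          s₀.R ∈ Matrix.specialOrthogonalGroup (Fin 3) ℝ →
          attEnergy P r K t₀ s₀ < ψ →
          lyap P r K t₀ s₀ p₁ p₂ < forceLevel P K p₂ fcM →
            (∃ s : ℝ → State, IsClosedLoop P r K t₀ s ∧ s t₀ = s₀) ∧
            ∀ s : ℝ → State, IsClosedLoop P r K t₀ s → s t₀ = s₀ →
              (∀ t, t₀ ≤ t →
                errNorm r K t (s t) ≤ C * Real.exp (-lam * (t - t₀)) * errNorm r K t₀ s₀) ∧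
              (∀ t, t₀ ≤ t → euclNorm (controlForce P r K t (s t)) ≤ fM) ∧
              (r.ConeFeasible P K θM t₀ s →
                ∀ t, t₀ ≤ t → InCone θM e3 (controlForce P r K t (s t))) := by
  obtain ⟨B, hB⟩ := hw
  have hF := hr.2
  have hm := P.m_pos
  obtain ⟨j, hj0, hj⟩ := PosDef.exists_le_dot P.J_posDef
  have hJ := lamMin_pos P.J_posDef
  -- Exactly the two lower bounds required for invariance of the level of `V_x`.
  set k := max (192 * ψ) (576 * ψ * fMd ^ 2 / fcM ^ 2) with hkdef
  have hk : 192 * ψ ≤ k := le_max_left _ _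
  have hk0 : 0 < k := by linarith
  have hk' : 576 * ψ * fMd ^ 2 ≤ k * fcM ^ 2 := by
    rw [← div_le_iff₀ (by positivity)]; exact le_max_right _ _
  have hh1 : 0 < √((scalarGains P k).h1 * lamMin P.J) := by
    rw [h1_scalarGains]; positivity
  have hjk : 0 < √(j / k) := by positivity
  obtain ⟨C, lam, hC, hlam, hexp⟩ := exists_exponential_bound P r hψ hk hk' hfcM hF hB
  -- In the choice of `p₁`, the first entry of the minimum gives the strict bound demanded by the
  -- statement, the second the nonnegativity of `V_R`.
  refine ⟨scalarGains P k, min (√((scalarGains P k).h1 * lamMin P.J) / 2) √(j / k), P.m / 4,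
    scalarGains_positive hk0, by rw [c1_scalarGains]; linarith,
    by simp only [scalarGains]; linarith, by positivity,
    (min_le_left _ _).trans_lt (by linarith), by positivity, ?_, C, lam, hC, hlam, ?_⟩
  · have : lamMin (scalarGains P k).Kx = P.m / 4 := lamMin_smul_one _
    rw [this]
    exact Real.lt_sqrt_of_sq_lt (by nlinarith)
  · intro t₀ s₀ ht₀ hR hE hV
    have hVx : lyapX P r (scalarGains P k) t₀ s₀ (P.m / 4) ≤ fcM ^ 2 / (2 * P.m) := by
      have h1 := lyapR_nonneg (P := P) (r := r) hk0 ht₀ hR hj0 hj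
        (p₁ := min (√((scalarGains P k).h1 * lamMin P.J) / 2) √(j / k)) (by positivity)
        (min_le_right _ _)
      have h2 := forceLevel_le (P := P) (k := k) (fcM := fcM)
      rw [lyap] at hV
      linarith
    refine ⟨exists_isClosedLoop ht₀ hR
      (exists_state_bound ht₀ hψ hk hk' hF hE hVx), fun s hs hs0 => ?_⟩
    subst hs0
    have hmot : ∀ t, IsMotionOn P r (scalarGains P k) (Set.Icc t₀ t) s := fun t =>
      hs.isMotionOn Set.Icc_subset_Ici_self
    have hNav : ∀ t, t₀ ≤ t → navFun r (scalarGains P k) t (s t) ≤ k := fun t ht =>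
      (navFun_le_attEnergy (P := P) _).trans
        (((hmot t).attEnergy_le ht₀ (Set.right_mem_Icc.mpr ht)).trans (by linarith))
    refine ⟨fun t ht => hexp t₀ t s ht₀ (hmot t) hE hVx t (Set.right_mem_Icc.mpr ht),
      fun t ht => ?_, fun hcone t ht =>
        inCone_controlForce hk0 (ht₀.trans ht) (hNav t ht) (hcone t ht)⟩
    have hlev := (hmot t).lyapX_le_level ht₀ hψ hk hk' hF hE hVx (Set.right_mem_Icc.mpr ht)
    have hf := controlForce_le hk0 (ht₀.trans ht) (hs.R_mem t ht) (hNav t ht)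
      (desiredForce_le hfcM.le (hF t (ht₀.trans ht)) hlev)
    linarith
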